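/- **Theorem (Odontoceti implements Byzantine Atomic Broadcast).** Consider $n=5f+1$ validators $V[0],\dots,V[n-1]$, of which at most $f$ are Byzantine (arbitrary behaviour) while the others are honest, and a number $\ell$ of leader slots per round with $1\le \ell\le 4f+1$. *Network.* Time is real. There are $\Delta>0$ and a time $\mathrm{GST}$ (unknown to the validators) such that a block broadcast by an honest validator at time $t$ is received, together with its causal history, by every honest validator by time $\max(t,\mathrm{GST})+\Delta$. Hashes are collision-free and signatures unforgeable: every block received by an honest validator was broadcast before by its author (strictly before, if the author is another validator). A validator knows its own blocks at once, and has received only finitely many blocks at any time. *Blocks.* A block consists of an author, a round $r\ge 1$, a payload and a list of references to parent blocks. It is valid if it and all blocks of its causal history satisfy the following: a round-1 block has no parents; the parents of a block of round $r\ge 2$ are blocks of round $r-1$, by at least $4f+1$ distinct validators, the first one by the block's own author. The local DAG of a validator consists of the received valid blocks whose whole causal history has been received. *Honest validators* broadcast one valid block per round, in order, starting with a round-1 block. The leader of rank $k$ ($0\le k<\ell$, rank $0$ is the highest) in round $r$ is $V[(r+k)\bmod n]$. An honest validator broadcasts its block of round $r+1$ as soon as it has broadcast its own round-$r$ block, its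 local DAG holds round-$r$ blocks of at least $4f+1$ validators, and either (a) for every leader of round $r$ its local DAG holds a round-$r$ block by that leader or round-$(r+1)$ blocks by at least $2f+1$ other validators none of which references a round-$r$ block of that leader (early block production), or (b) it has been waiting with the first two conditions satisfied for time $2\Delta$. The parents of the new block are taken from its local DAG, at most one per validator, including one by each leader of round $r$ of which the local DAG holds a round-$r$ block. *Decision rule.* In a local DAG $D$, a round-$(r+1)$ block supports a round-$r$ block $B$ if $B$ is among its parents, and blames $B$ otherwise; supports and blames are counted by distinct authors. The leader slots $(r,k)$ are ordered by round, then rank, and are processed from the last slot of the highest round of $D$ down to the first slot of round 1. Slot $(r,k)$ is directly committed with a block $B$ of the slot that has at least $4f+1$ supports; it is directly skipped if $D$ holds round-$(r+1)$ blocks of at least $4f+1$ validators and every block of the slot in $D$ has at least $4f+1$ blames. Otherwise its anchor is the first slot of a round $\ge r+2$ that is not skipped. If there is no anchor or the anchor is undecided, the slot is undecided. If the anchor is committed with a block $A$, the slot is committed with a block $B$ of the slot having at least $2f+1$ supports in the causal history of $A$ (chosen by a fixed deterministic rule if there are several), and skipped if there is none. The leader sequence consists of the committed blocks of the slots before the first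 undecided slot. The total ordering is obtained by going through the leader sequence and appending each time the blocks of the leader block's causal history (itself included) that are not yet in the ordering, in an order given by a fixed deterministic rule. The sequence of blocks *delivered* by a validator up to time $t$ is the total ordering computed from its local DAG at time $t$. Then every execution satisfies Byzantine Atomic Broadcast, with blocks as messages; that is, for all honest validators $p,q$: 1. **Validity.** If $p$ broadcasts a block $m$, then every honest validator eventually delivers $m$. 2. **Agreement.** If $p$ delivers $m$, then every honest validator eventually delivers $m$. 3. **Integrity.** $p$ delivers each block at most once, and only if it was previously broadcast by some validator; moreover the sequence delivered by $p$ is only ever appended to. 4. **Total order.** If $p$ and $q$ both deliver $m_1$ and $m_2$, then they deliver them in the same order. -/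

import Mathlib

universe u

namespace Odontoceti

/-! ### Byzantine Atomic Broadcast -/

/-- Byzantine Atomic Broadcast. `bcast p m t` says that `p` broadcasts `m` at time `t`, and `out p t`
is the sequence of messages that `p` has delivered up to time `t`, in order of delivery. -/
structure ByzantineAtomicBroadcast {V M T : Type*} [Preorder T] (honest : V → Prop)
    (bcast : V → M → T → Prop) (out : V → T → List M) : Prop where
  /-- Deliveries are irrevocable events: the delivered sequence is only ever appended to. -/
  append_only : ∀ p, honest p → ∀ s t, s ≤ t → out p s <+: out p t
  /-- A message broadcast by an honest participant is eventually delivered by all honest ones. -/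
  validity : ∀ p, honest p → ∀ m t, bcast p m t → ∀ q, honest q → ∃ t', m ∈ out q t'
  /-- A message delivered by an honest participant is eventually delivered by all honest ones. -/
  agreement : ∀ p, honest p → ∀ m t, m ∈ out p t → ∀ q, honest q → ∃ t', m ∈ out q t'
  /-- An honest participant delivers a message at most once, and only if it was broadcast before. -/
  integrity : ∀ p, honest p → ∀ t, (out p t).Nodup ∧
    ∀ m ∈ out p t, ∃ q, ∃ s ≤ t, bcast q m s
  /-- Two messages that two honest participants both deliver are delivered in the same order. -/
  total_order : ∀ p, honest p → ∀ q, honest q → ∀ m₁ m₂,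
    (∃ t, m₁ ∈ out p t) → (∃ t, m₂ ∈ out p t) → (∃ t, m₁ ∈ out q t) → (∃ t, m₂ ∈ out q t) →
    ((∃ t, [m₁, m₂].Sublist (out p t)) ↔ (∃ t, [m₁, m₂].Sublist (out q t)))

/-! ### Validators, blocks, causal history -/

/-- The `n = 5f + 1` validators. -/
abbrev Validator (f : ℕ) := Fin (5 * f + 1)

/-- A block. Hash references are idealised (no collisions), so that a block carries the
blocks it references; blocks are then equal exactly when all of their contents agree. Rounds are
numbered from 1. -/
structure Block (f : ℕ) (P : Type u) : Type u where
  author : Validator f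
  round : ℕ
  payload : P
  parents : List (Block f P)

/-- There is a chain of parent references from `new` down to `old` (possibly of length zero). -/
def Link {f : ℕ} {P : Type u} (old new : Block f P) : Prop :=
  Relation.ReflTransGen (fun a b : Block f P => a ∈ b.parents) old new

/-- The local conditions for validity. A block of the first round has no parents. A later block
references blocks of the previous round, by at least `4f + 1` distinct validators, and first of all
a block of its own author. -/
def WellFormed {f : ℕ} {P : Type u} (b : Block f P) : Prop :=
  (b.round = 1 ∧ b.parents = []) ∨
  (2 ≤ b.round ∧
    (∃ a, b.parents.head? = some a ∧ a.author = b.author) ∧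
    (∀ a ∈ b.parents, a.round + 1 = b.round) ∧
    4 * f + 1 ≤ (b.parents.map Block.author).toFinset.card)

open scoped Classical in
/-- The local DAG of a validator that has received the blocks in `R`: a block is incorporated once
it and its whole causal history have been received and verified. -/
noncomputable def acceptedDag {f : ℕ} {P : Type u} (R : Finset (Block f P)) :
    Finset (Block f P) :=
  R.filter fun b => ∀ a, Link a b → a ∈ R ∧ WellFormed a

open scoped Classical in
/-- The authors of the blocks in `D` that satisfy `φ`. -/
noncomputable def authorsOf {f : ℕ} {P : Type u} (D : Finset (Block f P))
    (φ : Block f P → Prop) : Finset (Validator f) :=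
  (D.filter φ).image Block.author

/-! ### Leader slots and the decision rule -/

/-- The leader of the given rank (0 is the highest) in a round: a round-robin schedule. -/
def leader (f r rank : ℕ) : Validator f :=
  ⟨(r + rank) % (5 * f + 1), Nat.mod_lt _ (Nat.succ_pos _)⟩

/-- The choices that the protocol leaves open: the number of leader slots per round, a
deterministic selection rule among the blocks of an equivocating leader, and the deterministic
order in which a finite set of blocks (the new part of a sub-DAG) is listed. -/
structure Config (f : ℕ) (P : Type u) where
  leadersPerRound : ℕ
  one_le_leaders : 1 ≤ leadersPerRound
  leaders_le : leadersPerRound ≤ 4 * f + 1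
  pick : Finset (Block f P) → Block f P
  pick_mem : ∀ s : Finset (Block f P), s.Nonempty → pick s ∈ s
  order : Finset (Block f P) → List (Block f P)
  order_nodup : ∀ s, (order s).Nodup
  mem_order : ∀ s b, b ∈ order s ↔ b ∈ s

/-- The state of a leader slot. -/
inductive Status (f : ℕ) (P : Type u) : Type u where
  | undecided : Status f P
  | skip : Status f P
  | commit (b : Block f P) : Status f P

open scoped Classical in
/-- The blocks of `D` in the leader slot `(r, rank)`; several if the leader equivocates. -/
noncomputable def leaderBlocks {f : ℕ} {P : Type u} (D : Finset (Block f P)) (r rank : ℕ) :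
    Finset (Block f P) :=
  D.filter fun b => b.round = r ∧ b.author = leader f r rank

/-- The validators with a block in the decide round of `b` (the round after it) supporting `b`. -/
noncomputable def supporters {f : ℕ} {P : Type u} (D : Finset (Block f P)) (b : Block f P) :
    Finset (Validator f) :=
  authorsOf D fun c => c.round = b.round + 1 ∧ b ∈ c.parents

/-- The validators with a block in the decide round of `b` blaming `b`. -/
noncomputable def blamers {f : ℕ} {P : Type u} (D : Finset (Block f P)) (b : Block f P) :
    Finset (Validator f) :=
  authorsOf D fun c => c.round = b.round + 1 ∧ b ∉ c.parents

open scoped Classical in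
/-- Step 1, the direct decision of the slot `(r, rank)`. A block of the slot with `4f + 1` supports
is committed; the slot is skipped if all of its blocks have `4f + 1` blames, where an empty slot is
blamed by every block of the decide round. -/
noncomputable def directDecide {f : ℕ} {P : Type u} (C : Config f P) (D : Finset (Block f P))
    (r rank : ℕ) : Status f P :=
  let supported := (leaderBlocks D r rank).filter fun b => 4 * f + 1 ≤ (supporters D b).card
  if supported.Nonempty then .commit (C.pick supported)
  else if 4 * f + 1 ≤ (authorsOf D fun c => c.round = r + 1).card ∧
      ∀ b ∈ leaderBlocks D r rank, 4 * f + 1 ≤ (blamers D b).card then .skip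
  else .undecided

/-- At least `2f + 1` validators have a block in the decide round of `b` that supports `b` and
belongs to the causal history of `anchor`. -/
def ThickLink {f : ℕ} {P : Type u} (D : Finset (Block f P)) (anchor b : Block f P) : Prop :=
  2 * f + 1 ≤
    (authorsOf D fun c => c.round = b.round + 1 ∧ b ∈ c.parents ∧ Link c anchor).card

open scoped Classical in
/-- Step 2, the indirect decision of the slot `(r, rank)`. The list `S` holds the rounds and states
of the slots after it, in ascending order; the anchor is the first slot outside of the wave
`{r, r + 1}` that is not skipped. -/
noncomputable def indirectDecide {f : ℕ} {P : Type u} (C : Config f P) (D : Finset (Block f P))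
    (r rank : ℕ) (S : List (ℕ × Status f P)) : Status f P :=
  match S.find? (fun s => decide (r + 1 < s.1 ∧ s.2 ≠ .skip)) with
  | some (_, .commit anchor) =>
    let linked := (leaderBlocks D r rank).filter fun b => ThickLink D anchor b
    if linked.Nonempty then .commit (C.pick linked) else .skip
  | _ => .undecided

/-- The state of the slot `(r, rank)`, given the states `S` of the slots after it. -/
noncomputable def decideSlot {f : ℕ} {P : Type u} (C : Config f P) (D : Finset (Block f P))
    (r rank : ℕ) (S : List (ℕ × Status f P)) : Status f P :=
  match directDecide C D r rank with
  | .undecided => indirectDecide C D r rank S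
  | status => status

/-- All leader slots `(r, rank)` of the rounds `1, …, hi`, by round and then rank. -/
def slots {f : ℕ} {P : Type u} (C : Config f P) (hi : ℕ) : List (ℕ × ℕ) :=
  (List.range' 1 hi).flatMap fun r => (List.range C.leadersPerRound).map fun rank => (r, rank)

/-- The states of all slots up to the highest round of `D`, computed from the last slot down to the
first and listed in ascending order. -/
noncomputable def tryDecide {f : ℕ} {P : Type u} (C : Config f P) (D : Finset (Block f P)) :
    List (ℕ × Status f P) :=
  (slots C (D.sup Block.round)).foldr (fun s S => (s.1, decideSlot C D s.1 s.2 S) :: S) []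

/-- The committed leader blocks in front of the first undecided slot. -/
def leaderSequence {f : ℕ} {P : Type u} : List (ℕ × Status f P) → List (Block f P)
  | (_, .commit b) :: S => b :: leaderSequence S
  | (_, .skip) :: S => leaderSequence S
  | (_, .undecided) :: _ => []
  | [] => []

open scoped Classical in
/-- The linearization: each leader block of the sequence in turn contributes those blocks of its
causal history (itself included) that are not in the total ordering yet. -/
noncomputable def linearizeSubDags {f : ℕ} {P : Type u} (C : Config f P) (D : Finset (Block f P))
    (L : List (Block f P)) : List (Block f P) :=
  L.foldl (fun log b => log ++ C.order (D.filter fun a => Link a b ∧ a ∉ log)) []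

/-- Step 3: the total ordering that a validator with local DAG `D` outputs. -/
noncomputable def totalOrdering {f : ℕ} {P : Type u} (C : Config f P) (D : Finset (Block f P)) :
    List (Block f P) :=
  linearizeSubDags C D (leaderSequence (tryDecide C D))

/-! ### Runs of the protocol -/

/-- What happens in a run, over real time: `bcast v b t` says that `v` broadcasts `b` at time `t`
(for a Byzantine `v`: signs it and sends it to someone), and `recv v t` is the finite set of
authentic blocks, its own included, that `v` has received up to time `t`. Every message sent from
time `gst` on takes at most `delta`. -/
structure Run (f : ℕ) (P : Type u) where
  delta : ℝ
  gst : ℝ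
  byzantine : Finset (Validator f)
  bcast : Validator f → Block f P → ℝ → Prop
  recv : Validator f → ℝ → Finset (Block f P)

namespace Run

variable {f : ℕ} {P : Type u}

def Honest (X : Run f P) (p : Validator f) : Prop := p ∉ X.byzantine

/-- The local DAG of `p` at time `t`. -/
noncomputable def dag (X : Run f P) (p : Validator f) (t : ℝ) : Finset (Block f P) :=
  acceptedDag (X.recv p t)

/-- The sequence of blocks that `p` has delivered up to time `t`. -/
noncomputable def delivered (X : Run f P) (C : Config f P) (p : Validator f) (t : ℝ) :
    List (Block f P) :=
  totalOrdering C (X.dag p t)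

/-- At time `t`, `p` has broadcast its block of round `r` and holds round-`r` blocks of `4f + 1`
validators: all that it needs for its next block, except possibly for leader blocks of round `r`. -/
def QuorumReady (X : Run f P) (p : Validator f) (r : ℕ) (t : ℝ) : Prop :=
  (∃ b, b.round = r ∧ ∃ s ≤ t, X.bcast p b s) ∧
  4 * f + 1 ≤ (authorsOf (X.dag p t) fun b => b.round = r).card

/-- `p` holds at time `t` a round-`r` block of the validator `l`. -/
def Holds (X : Run f P) (p : Validator f) (r : ℕ) (l : Validator f) (t : ℝ) : Prop :=
  ∃ a ∈ X.dag p t, a.round = r ∧ a.author = l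

/-- `p` holds at time `t` blames for the round-`r` leader `l` from `2f + 1` other validators. -/
def Blamed (X : Run f P) (p : Validator f) (r : ℕ) (l : Validator f) (t : ℝ) : Prop :=
  2 * f + 1 ≤ (authorsOf (X.dag p t) fun c =>
    c.round = r + 1 ∧ c.author ≠ p ∧ ∀ a ∈ c.parents, a.author ≠ l).card

/-- `p` may leave round `r` at time `t`: it is ready up to leader blocks, and either no leader is
left to wait for (each leader's block is there, or `2f + 1` blames show that the leader is slow), or
it has waited for the leaders for `2 * delta`. -/
def CanAdvance (X : Run f P) (C : Config f P) (p : Validator f) (r : ℕ) (t : ℝ) : Prop :=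
  X.QuorumReady p r t ∧
  ((∀ rank < C.leadersPerRound,
      X.Holds p r (leader f r rank) t ∨ X.Blamed p r (leader f r rank) t) ∨
    X.QuorumReady p r (t - 2 * X.delta))

/-- The behaviour of an honest validator. -/
structure FollowsProtocol (X : Run f P) (C : Config f P) (p : Validator f) : Prop where
  /-- It broadcasts only blocks of its own, and knows them at once. -/
  own : ∀ b t, X.bcast p b t → b.author = p ∧ b ∈ X.recv p t
  /-- It broadcasts at most one block per round. -/
  once : ∀ b t b' t', X.bcast p b t → X.bcast p b' t' → b.round = b'.round → b = b' ∧ t = t'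
  /-- It starts by broadcasting a block of the first round. -/
  start : ∃ b t, X.bcast p b t ∧ b.round = 1
  /-- It broadcasts valid blocks only. -/
  wellFormed : ∀ b t, X.bcast p b t → WellFormed b
  /-- A block of round `r + 1` is broadcast only when the validator may leave round `r`. Its parents
  are blocks of the local DAG, at most one per validator, and one from each leader of round `r` of
  which the local DAG holds a block. -/
  create : ∀ b t r, X.bcast p b t → 1 ≤ r → b.round = r + 1 →
    X.CanAdvance C p r t ∧ (∀ a ∈ b.parents, a ∈ X.dag p t) ∧
    (b.parents.map Block.author).Nodup ∧
    ∀ rank < C.leadersPerRound, X.Holds p r (leader f r rank) t →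
      ∃ a ∈ b.parents, a.author = leader f r rank
  /-- It broadcasts its block of round `r + 1` as soon as it may leave round `r`. -/
  prompt : ∀ r t, 1 ≤ r → X.CanAdvance C p r t → ∃ b, b.round = r + 1 ∧ ∃ s ≤ t, X.bcast p b s

/-- A run of the protocol in the partially synchronous model, with at most `f` Byzantine validators
(whose behaviour is unconstrained) and unforgeable signatures. -/
structure IsExecution (X : Run f P) (C : Config f P) : Prop where
  delta_pos : 0 < X.delta
  byzantine_card : X.byzantine.card ≤ f
  follows : ∀ p, X.Honest p → X.FollowsProtocol C p
  recv_mono : ∀ p, X.Honest p → ∀ s t, s ≤ t → X.recv p s ⊆ X.recv p t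
  /-- Signatures and causality: a received block was broadcast before by its author. -/
  authentic : ∀ p, X.Honest p → ∀ t, ∀ b ∈ X.recv p t,
    ∃ s ≤ t, X.bcast b.author b s ∧ (b.author ≠ p → s < t)
  /-- Partial synchrony: a block that an honest validator broadcasts at time `s` reaches every
  honest validator, together with its causal history, by time `max s gst + delta`. -/
  delivery : ∀ p, X.Honest p → ∀ q, X.Honest q → ∀ b s, X.bcast p b s →
    ∀ a, Link a b → ∀ t, max s X.gst + X.delta ≤ t → a ∈ X.recv q t

end Run

end Odontoceti

/-!
Safety. An honest validator has one block per round, and its parents have distinct authors. Hence two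
sets of authors of round-`(r + 1)` blocks, possibly from different local DAGs, whose sizes add up to
`6f + 2` have an honest block in common (`exists_common_block`). So `4f + 1` supports of a leader
block exclude `2f + 1` supports of an equivocating one, `4f + 1` blames exclude `2f + 1` supports, and
a block with `4f + 1` supports is thickly linked from every block of a round beyond its wave. Therefore
direct decisions agree with each other and with all indirect ones, and indirect decisions from the
same anchor agree since they depend only on the anchor's history. Going through the slots from the
last one down, any two local DAGs agree on the slots that both decide (`statesFrom_agree`), and a
growing DAG keeps its decisions (`statesFrom_persist`). For this, DAGs of different heights are
compared on a common list of slots, those above the height of a DAG being undecided. Leader sequences,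
and with them the total orderings, are thus comparable as prefixes, and only appended to.

Liveness. A validator that holds round-`(r + 1)` blocks of `2f + 1` validators has left round `r`
(`catch_up`), because these blocks either reference a given leader or blame it. After stabilization
this forces every honest round-`(r + 1)` block to reference the block of an honest round-`r` leader
(`exists_parent_honest_leader`): the first one that does not cannot be due to blames, one of which
would be an earlier honest one, and a timeout of `2 * delta` leaves the leader `delta` to catch up and
`delta` to deliver its block. So slots of honest leaders are eventually committed directly. Of the
cyclic order of validators, two consecutive ones are honest; when they have the highest rank in two
consecutive rounds `N` and `N + 1`, every earlier slot finds a committed anchor and is decided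
(`mem_leaderSequence_of_consecutive_commits`). A block of an honest validator is delivered with a
later block of the same validator as a leader, to which it is linked by the chain of own parents.
Agreement and total order follow, as the delivered sequences are comparable and grow without bound.
-/

namespace Odontoceti

variable {f : ℕ} {P : Type u}

/-! ### Quorum counting -/

lemma mem_authorsOf {D : Finset (Block f P)} {φ : Block f P → Prop} {v : Validator f} :
    v ∈ authorsOf D φ ↔ ∃ b ∈ D, φ b ∧ b.author = v := by
  classical
  simp [authorsOf, and_assoc]

lemma authorsOf_mono {D E : Finset (Block f P)} {φ ψ : Block f P → Prop} (hDE : D ⊆ E)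
    (h : ∀ b ∈ D, φ b → ψ b) : authorsOf D φ ⊆ authorsOf E ψ := by
  intro v hv
  obtain ⟨b, hb, hφ, rfl⟩ := mem_authorsOf.1 hv
  exact mem_authorsOf.2 ⟨b, hDE hb, h b hb hφ, rfl⟩

lemma card_le_card_sdiff_add {byz : Finset (Validator f)} (hbyz : byz.card ≤ f)
    (S : Finset (Validator f)) : S.card ≤ (S \ byz).card + f := by
  have := Finset.le_card_sdiff byz S
  omega

lemma card_add_card_le_card_inter_add (S T : Finset (Validator f)) :
    S.card + T.card ≤ (S ∩ T).card + (5 * f + 1) := by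
  have h1 := Finset.card_union_add_card_inter S T
  have h2 := Finset.card_le_univ (S ∪ T)
  simp only [Fintype.card_fin] at h2
  omega

/-- Two sets of validators whose sizes add up to more than `n + f` share an honest validator. -/
lemma exists_honest_mem_inter {byz : Finset (Validator f)} (hbyz : byz.card ≤ f)
    {S T : Finset (Validator f)} (h : 6 * f + 2 ≤ S.card + T.card) :
    ∃ v, v ∉ byz ∧ v ∈ S ∧ v ∈ T := by
  have h1 := card_add_card_le_card_inter_add S T
  have h2 := card_le_card_sdiff_add hbyz (S ∩ T)
  obtain ⟨v, hv⟩ := Finset.card_pos.1 (show 0 < ((S ∩ T) \ byz).card by omega)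
  simp only [Finset.mem_sdiff, Finset.mem_inter] at hv
  exact ⟨v, hv.2, hv.1⟩

/-! ### Causal history -/

lemma Link.trans {a b c : Block f P} (h₁ : Link a b) (h₂ : Link b c) : Link a c :=
  Relation.ReflTransGen.trans h₁ h₂

lemma Link.of_mem_parents {a b : Block f P} (h : a ∈ b.parents) : Link a b :=
  Relation.ReflTransGen.single h

lemma Link.eq_or_exists_parent {a b : Block f P} (h : Link a b) :
    a = b ∨ ∃ c ∈ b.parents, Link a c := by
  rcases Relation.ReflTransGen.cases_tail h with h | ⟨c, hc, hcb⟩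
  · exact Or.inl h.symm
  · exact Or.inr ⟨c, hcb, hc⟩

/-- The causal history of a well-formed block contains, in every earlier round, blocks of a quorum
of validators. -/
lemma card_authorsOf_history {D : Finset (Block f P)}
    (hclosed : ∀ b ∈ D, ∀ a, Link a b → a ∈ D) (hwf : ∀ b ∈ D, WellFormed b)
    {b : Block f P} (hb : b ∈ D) {r : ℕ} (hr : 1 ≤ r) (hrb : r < b.round) :
    4 * f + 1 ≤ (authorsOf D fun c => c.round = r ∧ Link c b).card := by
  classical
  obtain ⟨k, hk⟩ := Nat.exists_eq_add_of_lt hrb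
  induction k generalizing b with
  | zero =>
    rcases hwf b hb with ⟨h1, -⟩ | ⟨-, -, hround, hcard⟩
    · omega
    · refine hcard.trans (Finset.card_le_card fun v hv => ?_)
      simp only [List.mem_toFinset, List.mem_map] at hv
      obtain ⟨a, ha, rfl⟩ := hv
      have := hround a ha
      exact mem_authorsOf.2 ⟨a, hclosed b hb a (.of_mem_parents ha),
        ⟨by omega, .of_mem_parents ha⟩, rfl⟩
  | succ k ih =>
    rcases hwf b hb with ⟨h1, -⟩ | ⟨-, ⟨a, ha, -⟩, hround, -⟩
    · omega
    · have ha' : a ∈ b.parents := List.mem_of_mem_head? ha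
      have := hround a ha'
      refine (ih (hclosed b hb a (.of_mem_parents ha')) (by omega) (by omega)).trans
        (Finset.card_le_card (authorsOf_mono subset_rfl fun c _ hc => ⟨hc.1, ?_⟩))
      exact hc.2.trans (.of_mem_parents ha')

/-! ### Local DAGs and honest blocks -/

/-- What the safety argument uses about the local DAGs of honest validators. The set `H` stands for
the blocks that honest validators have broadcast in the run. -/
structure IsLocalDag (byz : Finset (Validator f)) (H : Set (Block f P)) (D : Finset (Block f P)) :
    Prop where
  closed : ∀ b ∈ D, ∀ a, Link a b → a ∈ D
  wellFormed : ∀ b ∈ D, WellFormed b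
  honest_mem : ∀ b ∈ D, b.author ∉ byz → b ∈ H

/-- The constraints on the blocks `H` of honest validators: there is one per author and round, and
its parents have distinct authors. -/
structure HonestBlocks (H : Set (Block f P)) : Prop where
  unique : ∀ b ∈ H, ∀ c ∈ H, b.author = c.author → b.round = c.round → b = c
  parents_nodup : ∀ b ∈ H, (b.parents.map Block.author).Nodup

section Safety

variable {byz : Finset (Validator f)} {H : Set (Block f P)} {D E : Finset (Block f P)}

/-- If properties `φ` and `ψ` of round-`r` blocks are witnessed in two local DAGs by sufficiently
many authors, some honest block, present in both, has both properties. -/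
lemma exists_common_block (hbyz : byz.card ≤ f) (hH : HonestBlocks H) (hD : IsLocalDag byz H D)
    (hE : IsLocalDag byz H E) {r : ℕ} {φ ψ : Block f P → Prop}
    (hφ : ∀ b, φ b → b.round = r) (hψ : ∀ b, ψ b → b.round = r)
    (h : 6 * f + 2 ≤ (authorsOf D φ).card + (authorsOf E ψ).card) :
    ∃ c ∈ H, c ∈ D ∧ c ∈ E ∧ φ c ∧ ψ c := by
  obtain ⟨v, hv, h1, h2⟩ := exists_honest_mem_inter hbyz h
  obtain ⟨c, hc, hφc, rfl⟩ := mem_authorsOf.1 h1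
  obtain ⟨d, hd, hψd, hdc⟩ := mem_authorsOf.1 h2
  have hcH := hD.honest_mem c hc hv
  have hdH := hE.honest_mem d hd (hdc ▸ hv)
  obtain rfl := hH.unique c hcH d hdH hdc.symm ((hφ c hφc).trans (hψ d hψd).symm)
  exact ⟨c, hcH, hc, hd, hφc, hψd⟩

/-- A block with `4f + 1` supports excludes `2f + 1` supports for an equivocating block. -/
lemma eq_of_supporters (hbyz : byz.card ≤ f) (hH : HonestBlocks H) (hD : IsLocalDag byz H D)
    (hE : IsLocalDag byz H E) {b b' : Block f P} (hround : b.round = b'.round)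
    (hauthor : b.author = b'.author) (hb : 4 * f + 1 ≤ (supporters D b).card)
    (hb' : 2 * f + 1 ≤ (supporters E b').card) : b = b' := by
  obtain ⟨c, hcH, -, -, ⟨-, h1⟩, -, h2⟩ := exists_common_block (r := b.round + 1) hbyz hH hD hE
    (fun _ h => h.1) (fun _ h => hround ▸ h.1)
    (show 6 * f + 2 ≤ (supporters D b).card + (supporters E b').card by omega)
  exact List.inj_on_of_nodup_map (hH.parents_nodup c hcH) h1 h2 hauthor

/-- `4f + 1` blames of a block exclude `2f + 1` supports. -/
lemma not_blamers_and_supporters (hbyz : byz.card ≤ f) (hH : HonestBlocks H)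
    (hD : IsLocalDag byz H D) (hE : IsLocalDag byz H E) {b : Block f P}
    (hb : 4 * f + 1 ≤ (blamers D b).card) (hb' : 2 * f + 1 ≤ (supporters E b).card) : False := by
  obtain ⟨c, -, -, -, ⟨-, h1⟩, -, h2⟩ := exists_common_block (r := b.round + 1) hbyz hH hD hE
    (fun _ h => h.1) (fun _ h => h.1)
    (show 6 * f + 2 ≤ (blamers D b).card + (supporters E b).card by omega)
  exact h1 h2

/-- A block with `4f + 1` supports is thickly linked from every block outside of its wave. -/
lemma thickLink_of_supporters (hbyz : byz.card ≤ f) (hH : HonestBlocks H)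
    (hD : IsLocalDag byz H D) (hE : IsLocalDag byz H E) {a b : Block f P}
    (hb : 4 * f + 1 ≤ (supporters D b).card) (ha : a ∈ E) (hab : b.round + 1 < a.round) :
    ThickLink E a b := by
  have h1 := card_authorsOf_history hE.closed hE.wellFormed ha (Nat.le_add_left 1 b.round) hab
  set T := authorsOf E fun c => c.round = b.round + 1 ∧ Link c a
  have h2 := card_add_card_le_card_inter_add (supporters D b \ byz) T
  have h3 := card_le_card_sdiff_add hbyz (supporters D b)
  refine le_trans (by omega) (Finset.card_le_card (s := (supporters D b \ byz) ∩ T) fun v hv => ?_)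
  simp only [Finset.mem_inter, Finset.mem_sdiff] at hv
  obtain ⟨⟨hvD, hvb⟩, hvT⟩ := hv
  obtain ⟨c, hc, ⟨hcr, hcb⟩, rfl⟩ := mem_authorsOf.1 hvD
  obtain ⟨d, hd, ⟨hdr, hda⟩, hdc⟩ := mem_authorsOf.1 hvT
  obtain rfl := hH.unique c (hD.honest_mem c hc hvb) d (hE.honest_mem d hd (hdc ▸ hvb)) hdc.symm
    (hcr.trans hdr.symm)
  exact mem_authorsOf.2 ⟨c, hd, ⟨hcr, hcb, hda⟩, rfl⟩

lemma ThickLink.le_card_supporters {a b : Block f P} (h : ThickLink D a b) :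
    2 * f + 1 ≤ (supporters D b).card :=
  h.trans (Finset.card_le_card (authorsOf_mono subset_rfl fun _ _ hc => ⟨hc.1, hc.2.1⟩))

/-- A block that has a supporter in a local DAG belongs to the DAG. -/
lemma mem_of_supporters (hD : IsLocalDag byz H D) {b : Block f P}
    (h : 0 < (supporters D b).card) : b ∈ D := by
  obtain ⟨v, hv⟩ := Finset.card_pos.1 h
  obtain ⟨c, hc, ⟨-, hbc⟩, -⟩ := mem_authorsOf.1 hv
  exact hD.closed c hc b (.of_mem_parents hbc)

/-! ### The direct decision -/

lemma mem_leaderBlocks {r rank : ℕ} {b : Block f P} :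
    b ∈ leaderBlocks D r rank ↔ b ∈ D ∧ b.round = r ∧ b.author = leader f r rank := by
  classical
  simp [leaderBlocks]

variable {C : Config f P} {r rank : ℕ}

lemma directDecide_eq_commit {b : Block f P} (h : directDecide C D r rank = .commit b) :
    b ∈ leaderBlocks D r rank ∧ 4 * f + 1 ≤ (supporters D b).card := by
  classical
  unfold directDecide at h
  dsimp only at h
  split_ifs at h with h1 h2
  have h3 := C.pick_mem _ h1
  simp only [Status.commit.injEq] at h
  rw [h] at h3
  simpa using h3

lemma exists_directDecide_eq_commit_of_supporters {b : Block f P} (hb : b ∈ leaderBlocks D r rank)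
    (h : 4 * f + 1 ≤ (supporters D b).card) : ∃ b', directDecide C D r rank = .commit b' := by
  classical
  unfold directDecide
  dsimp only
  rw [if_pos ⟨b, Finset.mem_filter.2 ⟨hb, h⟩⟩]
  exact ⟨_, rfl⟩

/-- In a directly skipped slot, every conceivable block has `4f + 1` blames, whether or not it is in
the local DAG: a block outside of the DAG is blamed by the whole decide round. -/
lemma le_card_blamers_of_directDecide_eq_skip (hD : IsLocalDag byz H D)
    (h : directDecide C D r rank = .skip) :
    4 * f + 1 ≤ (authorsOf D fun c => c.round = r + 1).card ∧
    ∀ b : Block f P, b.round = r → b.author = leader f r rank →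
      4 * f + 1 ≤ (blamers D b).card := by
  classical
  unfold directDecide at h
  dsimp only at h
  split_ifs at h with h1 h2
  refine ⟨h2.1, fun b hbr hba => ?_⟩
  by_cases hb : b ∈ D
  · exact h2.2 b (mem_leaderBlocks.2 ⟨hb, hbr, hba⟩)
  · refine h2.1.trans (Finset.card_le_card (authorsOf_mono subset_rfl fun c hc hcr =>
      ⟨by omega, fun hbc => hb (hD.closed c hc b (.of_mem_parents hbc))⟩))

/-- A direct decision stays possible when the local DAG grows. -/
lemma directDecide_ne_undecided_mono (hD : IsLocalDag byz H D) (hDE : D ⊆ E)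
    (h : directDecide C D r rank ≠ .undecided) : directDecide C E r rank ≠ .undecided := by
  classical
  cases hd : directDecide C D r rank with
  | undecided => exact absurd hd h
  | commit b =>
    obtain ⟨h1, h2⟩ := directDecide_eq_commit hd
    have h3 : b ∈ leaderBlocks E r rank :=
      mem_leaderBlocks.2 ((mem_leaderBlocks.1 h1).imp_left fun h => hDE h)
    obtain ⟨b', hb'⟩ := exists_directDecide_eq_commit_of_supporters (C := C) h3
      (h2.trans (Finset.card_le_card (authorsOf_mono hDE fun _ _ h => h)))
    simp [hb']
  | skip =>
    obtain ⟨h1, h2⟩ := le_card_blamers_of_directDecide_eq_skip hD hd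
    unfold directDecide
    dsimp only
    split_ifs with h3 h4
    · simp
    · simp
    · refine absurd ⟨h1.trans (Finset.card_le_card (authorsOf_mono hDE fun _ _ h => h)), ?_⟩ h4
      intro b hb
      obtain ⟨-, hbr, hba⟩ := mem_leaderBlocks.1 hb
      exact (h2 b hbr hba).trans (Finset.card_le_card (authorsOf_mono hDE fun _ _ h => h))

/-- From the highest round of a DAG on, nothing is decided directly. -/
lemma directDecide_eq_undecided (h : ∀ b ∈ D, b.round < r + 1) :
    directDecide C D r rank = .undecided := by
  classical
  unfold directDecide
  dsimp only
  split_ifs with h1 h2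
  · obtain ⟨b, hb⟩ := h1
    obtain ⟨hb, hcard⟩ := Finset.mem_filter.1 hb
    obtain ⟨v, hv⟩ := Finset.card_pos.1 (show 0 < (supporters D b).card by omega)
    obtain ⟨c, hc, ⟨hcr, -⟩, -⟩ := mem_authorsOf.1 hv
    have := h c hc
    have := (mem_leaderBlocks.1 hb).2.1
    omega
  · obtain ⟨v, hv⟩ := Finset.card_pos.1
      (show 0 < (authorsOf D fun c => c.round = r + 1).card by omega)
    obtain ⟨c, hc, hcr, -⟩ := mem_authorsOf.1 hv
    have := h c hc
    omega
  · rfl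

/-! ### The indirect decision -/

open scoped Classical in
/-- The anchor of a slot of round `r`, with its round, if there is one; `S` holds the states of the
slots after it. -/
noncomputable def anchor? (r : ℕ) (S : List (ℕ × Status f P)) : Option (ℕ × Status f P) :=
  S.find? fun s => decide (r + 1 < s.1 ∧ s.2 ≠ .skip)

open scoped Classical in
/-- The indirect decision of the slot `(r, rank)` from a committed anchor `a`. -/
noncomputable def decideFrom (C : Config f P) (D : Finset (Block f P)) (r rank : ℕ)
    (a : Block f P) : Status f P :=
  if ((leaderBlocks D r rank).filter fun b => ThickLink D a b).Nonempty then
    .commit (C.pick ((leaderBlocks D r rank).filter fun b => ThickLink D a b))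
  else .skip

lemma decideFrom_ne_undecided (a : Block f P) : decideFrom C D r rank a ≠ .undecided := by
  unfold decideFrom
  split_ifs <;> simp

lemma indirectDecide_of_anchor {S : List (ℕ × Status f P)} {ρ : ℕ} {a : Block f P}
    (h : anchor? r S = some (ρ, .commit a)) :
    indirectDecide C D r rank S = decideFrom C D r rank a := by
  unfold indirectDecide
  unfold anchor? at h
  rw [h]
  rfl

lemma exists_anchor_of_indirectDecide {S : List (ℕ × Status f P)}
    (h : indirectDecide C D r rank S ≠ .undecided) :
    ∃ ρ a, anchor? r S = some (ρ, .commit a) := by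
  unfold indirectDecide at h
  unfold anchor?
  split at h
  · rename_i ρ a heq
    exact ⟨ρ, a, heq⟩
  · exact absurd rfl h

lemma decideSlot_of_direct {S : List (ℕ × Status f P)} {σ : Status f P}
    (h : directDecide C D r rank = σ) (hσ : σ ≠ .undecided) :
    decideSlot C D r rank S = σ := by
  unfold decideSlot
  rw [h]
  cases σ <;> simp_all

lemma decideSlot_of_indirect {S : List (ℕ × Status f P)}
    (h : directDecide C D r rank = .undecided) :
    decideSlot C D r rank S = indirectDecide C D r rank S := by
  unfold decideSlot
  rw [h]

lemma decideSlot_ne_undecided {S : List (ℕ × Status f P)} {ρ : ℕ} {a : Block f P}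
    (h : anchor? r S = some (ρ, .commit a)) : decideSlot C D r rank S ≠ .undecided := by
  by_cases hd : directDecide C D r rank = .undecided
  · rw [decideSlot_of_indirect hd, indirectDecide_of_anchor h]
    exact decideFrom_ne_undecided a
  · rw [decideSlot_of_direct rfl hd]
    exact hd

lemma decideFrom_eq_commit {a b : Block f P} (h : decideFrom C D r rank a = .commit b) :
    b ∈ leaderBlocks D r rank ∧ ThickLink D a b := by
  classical
  unfold decideFrom at h
  split_ifs at h with h1
  have h2 := C.pick_mem _ h1
  simp only [Status.commit.injEq] at h
  rw [h] at h2
  simpa using h2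

lemma decideSlot_eq_commit {S : List (ℕ × Status f P)} {b : Block f P}
    (h : decideSlot C D r rank S = .commit b) : b ∈ leaderBlocks D r rank := by
  by_cases hd : directDecide C D r rank = .undecided
  · rw [decideSlot_of_indirect hd] at h
    obtain ⟨ρ, a, ha⟩ := exists_anchor_of_indirectDecide (C := C) (D := D) (r := r) (rank := rank)
      (S := S) (by simp [h])
    rw [indirectDecide_of_anchor ha] at h
    exact (decideFrom_eq_commit h).1
  · rw [decideSlot_of_direct rfl hd] at h
    exact (directDecide_eq_commit h).1

lemma mem_of_anchor {S : List (ℕ × Status f P)} {s : ℕ × Status f P} (h : anchor? r S = some s) :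
    s ∈ S ∧ r + 1 < s.1 := by
  classical
  refine ⟨List.mem_of_find?_eq_some h, ?_⟩
  have := List.find?_some h
  simp only [decide_eq_true_eq] at this
  exact this.1

/-- The indirect decision from a given anchor depends only on the anchor's causal history. -/
lemma decideFrom_congr (hD : IsLocalDag byz H D) (hE : IsLocalDag byz H E) {a : Block f P}
    (haD : a ∈ D) (haE : a ∈ E) : decideFrom C D r rank a = decideFrom C E r rank a := by
  classical
  have key : ∀ {D E : Finset (Block f P)}, IsLocalDag byz H D → IsLocalDag byz H E → a ∈ E →
      ((leaderBlocks D r rank).filter fun b => ThickLink D a b) ⊆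
        (leaderBlocks E r rank).filter fun b => ThickLink E a b := by
    intro D E _ hE haE b hb
    rw [Finset.mem_filter, mem_leaderBlocks] at hb ⊢
    obtain ⟨⟨-, hbr, hba⟩, hl⟩ := hb
    have hl' : ThickLink E a b := by
      refine hl.trans (Finset.card_le_card fun v hv => ?_)
      obtain ⟨c, -, hc, rfl⟩ := mem_authorsOf.1 hv
      exact mem_authorsOf.2 ⟨c, hE.closed a haE c hc.2.2, hc, rfl⟩
    have := hl'.le_card_supporters
    exact ⟨⟨mem_of_supporters hE (by omega), hbr, hba⟩, hl'⟩
  have := (key hD hE haE).antisymm (key hE hD haD)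
  unfold decideFrom
  rw [this]

/-- A direct decision agrees with every indirect decision in another local DAG. -/
lemma decideFrom_eq_directDecide (hbyz : byz.card ≤ f) (hH : HonestBlocks H)
    (hD : IsLocalDag byz H D) (hE : IsLocalDag byz H E) (h : directDecide C D r rank ≠ .undecided)
    {a : Block f P} (ha : a ∈ E) (har : r + 1 < a.round) :
    decideFrom C E r rank a = directDecide C D r rank := by
  classical
  cases hd : directDecide C D r rank with
  | undecided => exact absurd hd h
  | commit b =>
    obtain ⟨h1, h2⟩ := directDecide_eq_commit hd
    obtain ⟨-, hbr, hba⟩ := mem_leaderBlocks.1 h1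
    cases he : decideFrom C E r rank a with
    | undecided => exact absurd he (decideFrom_ne_undecided a)
    | commit b' =>
      obtain ⟨h3, h4⟩ := decideFrom_eq_commit he
      obtain ⟨-, hbr', hba'⟩ := mem_leaderBlocks.1 h3
      rw [eq_of_supporters hbyz hH hD hE (hbr.trans hbr'.symm) (hba.trans hba'.symm) h2
        h4.le_card_supporters]
    | skip =>
      have h3 := thickLink_of_supporters hbyz hH hD hE h2 ha (hbr ▸ har)
      have h4 := h3.le_card_supporters
      unfold decideFrom at he
      split_ifs at he with h5
      exact absurd ⟨b, Finset.mem_filter.2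
        ⟨mem_leaderBlocks.2 ⟨mem_of_supporters hE (by omega), hbr, hba⟩, h3⟩⟩ h5
  | skip =>
    obtain ⟨-, h2⟩ := le_card_blamers_of_directDecide_eq_skip hD hd
    cases he : decideFrom C E r rank a with
    | undecided => exact absurd he (decideFrom_ne_undecided a)
    | skip => rfl
    | commit b' =>
      obtain ⟨h3, h4⟩ := decideFrom_eq_commit he
      obtain ⟨-, hbr', hba'⟩ := mem_leaderBlocks.1 h3
      exact (not_blamers_and_supporters hbyz hH hD hE (h2 b' hbr' hba')
        h4.le_card_supporters).elim

/-- Direct decisions in two local DAGs agree. -/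
lemma directDecide_agree (hbyz : byz.card ≤ f) (hH : HonestBlocks H)
    (hD : IsLocalDag byz H D) (hE : IsLocalDag byz H E) (h : directDecide C D r rank ≠ .undecided)
    (h' : directDecide C E r rank ≠ .undecided) :
    directDecide C D r rank = directDecide C E r rank := by
  cases hd : directDecide C D r rank with
  | undecided => exact absurd hd h
  | commit b =>
    obtain ⟨h1, h2⟩ := directDecide_eq_commit hd
    obtain ⟨-, hbr, hba⟩ := mem_leaderBlocks.1 h1
    cases he : directDecide C E r rank with
    | undecided => exact absurd he h'
    | commit b' =>
      obtain ⟨h3, h4⟩ := directDecide_eq_commit he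
      obtain ⟨-, hbr', hba'⟩ := mem_leaderBlocks.1 h3
      rw [eq_of_supporters hbyz hH hD hE (hbr.trans hbr'.symm) (hba.trans hba'.symm) h2 (by omega)]
    | skip =>
      exact (not_blamers_and_supporters hbyz hH hE hD
        ((le_card_blamers_of_directDecide_eq_skip hE he).2 b hbr hba) (by omega)).elim
  | skip =>
    cases he : directDecide C E r rank with
    | undecided => exact absurd he h'
    | skip => rfl
    | commit b' =>
      obtain ⟨h3, h4⟩ := directDecide_eq_commit he
      obtain ⟨-, hbr', hba'⟩ := mem_leaderBlocks.1 h3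
      exact (not_blamers_and_supporters hbyz hH hD hE
        ((le_card_blamers_of_directDecide_eq_skip hD hd).2 b' hbr' hba') (by omega)).elim

end Safety

/-! ### Comparing the states of all slots in two local DAGs -/

/-- The states of the slots `L`, computed from the last to the first, followed by the states `S` of
later slots. -/
noncomputable def statesFrom (C : Config f P) (D : Finset (Block f P)) (L : List (ℕ × ℕ))
    (S : List (ℕ × Status f P)) : List (ℕ × Status f P) :=
  L.foldr (fun s S => (s.1, decideSlot C D s.1 s.2 S) :: S) S

/-- Two states do not contradict each other. -/
def Status.Agree (σ τ : Status f P) : Prop :=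
  σ ≠ .undecided → τ ≠ .undecided → σ = τ

/-- The second state extends the first one: a decision is kept. -/
def Status.Persist (σ τ : Status f P) : Prop :=
  σ ≠ .undecided → τ = σ

section States

variable {C : Config f P} {D E : Finset (Block f P)}

@[simp] lemma statesFrom_nil (S : List (ℕ × Status f P)) : statesFrom C D [] S = S := rfl

@[simp] lemma statesFrom_cons (s : ℕ × ℕ) (L : List (ℕ × ℕ)) (S : List (ℕ × Status f P)) :
    statesFrom C D (s :: L) S =
      (s.1, decideSlot C D s.1 s.2 (statesFrom C D L S)) :: statesFrom C D L S := rfl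

lemma statesFrom_append (L L' : List (ℕ × ℕ)) (S : List (ℕ × Status f P)) :
    statesFrom C D (L ++ L') S = statesFrom C D L (statesFrom C D L' S) := by
  simp [statesFrom]

lemma mem_dag_of_mem_statesFrom {L : List (ℕ × ℕ)} {ρ : ℕ} {b : Block f P}
    (h : (ρ, Status.commit b) ∈ statesFrom C D L []) : b ∈ D ∧ b.round = ρ := by
  induction L with
  | nil => simp at h
  | cons s L ih =>
    rw [statesFrom_cons, List.mem_cons] at h
    rcases h with h | h
    · obtain ⟨rfl, hb⟩ := Prod.mk.inj h
      obtain ⟨h1, h2, -⟩ := mem_leaderBlocks.1 (decideSlot_eq_commit hb.symm)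
      exact ⟨h1, h2⟩
    · exact ih h

open scoped Classical in
lemma anchor?_cons (r : ℕ) (s : ℕ × Status f P) (S : List (ℕ × Status f P)) :
    anchor? r (s :: S) = if r + 1 < s.1 ∧ s.2 ≠ .skip then some s else anchor? r S := by
  unfold anchor?
  rw [List.find?_cons]
  split_ifs with h <;> simp [h]

/-- If the states of two DAGs do not contradict each other, then neither do committed anchors. -/
lemma anchor?_agree {r ρ ρ' : ℕ} {a a' : Block f P} {S T : List (ℕ × Status f P)}
    (h : List.Forall₂ (fun s t => s.1 = t.1 ∧ s.2.Agree t.2) S T)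
    (hS : anchor? r S = some (ρ, .commit a)) (hT : anchor? r T = some (ρ', .commit a')) :
    a = a' := by
  induction h with
  | nil => simp [anchor?] at hS
  | @cons s t S T hst hST ih =>
    obtain ⟨s1, s2⟩ := s
    obtain ⟨t1, t2⟩ := t
    obtain ⟨rfl, hst⟩ := hst
    rw [anchor?_cons] at hS hT
    dsimp only at hS hT hst
    split_ifs at hS hT with h1 h2 h2
    · simp only [Option.some.injEq, Prod.mk.injEq] at hS hT
      obtain ⟨-, rfl⟩ := hS
      obtain ⟨-, rfl⟩ := hT
      simpa using hst (by simp) (by simp)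
    · simp only [Option.some.injEq, Prod.mk.injEq] at hS
      obtain ⟨-, rfl⟩ := hS
      have h3 : t2 = .skip := by simpa [h1.1] using h2
      subst h3
      simpa using hst (by simp) (by simp)
    · simp only [Option.some.injEq, Prod.mk.injEq] at hT
      obtain ⟨-, rfl⟩ := hT
      have h3 : s2 = .skip := by simpa [h2.1] using h1
      subst h3
      simpa using hst (by simp) (by simp)
    · exact ih hS hT

lemma anchor?_persist {r ρ : ℕ} {a : Block f P} {S T : List (ℕ × Status f P)}
    (h : List.Forall₂ (fun s t => s.1 = t.1 ∧ s.2.Persist t.2) S T)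
    (hS : anchor? r S = some (ρ, .commit a)) : anchor? r T = some (ρ, .commit a) := by
  induction h with
  | nil => simp [anchor?] at hS
  | @cons s t S T hst hST ih =>
    obtain ⟨s1, s2⟩ := s
    obtain ⟨t1, t2⟩ := t
    obtain ⟨rfl, hst⟩ := hst
    rw [anchor?_cons] at hS ⊢
    dsimp only at hS hst ⊢
    split_ifs at hS with h1
    · simp only [Option.some.injEq, Prod.mk.injEq] at hS
      obtain ⟨rfl, rfl⟩ := hS
      obtain rfl := hst (by simp)
      rw [if_pos h1]
    · by_cases h2 : s2 = .skip
      · obtain rfl : t2 = s2 := hst (by simp [h2])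
        rw [if_neg h1]
        exact ih hS
      · have h3 : ¬ (s1 > r + 1) := fun h => h1 ⟨h, h2⟩
        rw [if_neg fun h => h3 h.1]
        exact ih hS

variable {byz : Finset (Validator f)} {H : Set (Block f P)}

/-- Any two local DAGs agree on the slots that both decide. -/
lemma statesFrom_agree (hbyz : byz.card ≤ f) (hH : HonestBlocks H)
    (hD : IsLocalDag byz H D) (hE : IsLocalDag byz H E) (L : List (ℕ × ℕ)) :
    List.Forall₂ (fun s t => s.1 = t.1 ∧ s.2.Agree t.2) (statesFrom C D L [])
      (statesFrom C E L []) := by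
  induction L with
  | nil => exact .nil
  | cons s L ih =>
    rw [statesFrom_cons, statesFrom_cons]
    refine .cons ⟨rfl, ?_⟩ ih
    dsimp only
    generalize hS : statesFrom C D L [] = S at ih
    generalize hT : statesFrom C E L [] = T at ih
    have hSD : ∀ {ρ a}, anchor? s.1 S = some (ρ, .commit a) → a ∈ D ∧ s.1 + 1 < a.round := by
      intro ρ a h
      obtain ⟨h1, h2⟩ := mem_of_anchor h
      obtain ⟨h3, rfl⟩ := mem_dag_of_mem_statesFrom (hS ▸ h1)
      exact ⟨h3, h2⟩
    have hTE : ∀ {ρ a}, anchor? s.1 T = some (ρ, .commit a) → a ∈ E ∧ s.1 + 1 < a.round := by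
      intro ρ a h
      obtain ⟨h1, h2⟩ := mem_of_anchor h
      obtain ⟨h3, rfl⟩ := mem_dag_of_mem_statesFrom (hT ▸ h1)
      exact ⟨h3, h2⟩
    intro h1 h2
    by_cases hd : directDecide C D s.1 s.2 = .undecided <;>
      by_cases he : directDecide C E s.1 s.2 = .undecided
    · rw [decideSlot_of_indirect hd] at h1 ⊢
      rw [decideSlot_of_indirect he] at h2 ⊢
      obtain ⟨ρ, a, ha⟩ := exists_anchor_of_indirectDecide h1
      obtain ⟨ρ', a', ha'⟩ := exists_anchor_of_indirectDecide h2
      obtain rfl := anchor?_agree ih ha ha'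
      rw [indirectDecide_of_anchor ha, indirectDecide_of_anchor ha',
        decideFrom_congr hD hE (hSD ha).1 (hTE ha').1]
    · rw [decideSlot_of_indirect hd] at h1 ⊢
      rw [decideSlot_of_direct rfl he]
      obtain ⟨ρ, a, ha⟩ := exists_anchor_of_indirectDecide h1
      rw [indirectDecide_of_anchor ha]
      exact decideFrom_eq_directDecide hbyz hH hE hD he (hSD ha).1 (hSD ha).2
    · rw [decideSlot_of_indirect he] at h2 ⊢
      rw [decideSlot_of_direct rfl hd]
      obtain ⟨ρ, a, ha⟩ := exists_anchor_of_indirectDecide h2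
      rw [indirectDecide_of_anchor ha]
      exact (decideFrom_eq_directDecide hbyz hH hD hE hd (hTE ha).1 (hTE ha).2).symm
    · rw [decideSlot_of_direct rfl hd, decideSlot_of_direct rfl he]
      exact directDecide_agree hbyz hH hD hE hd he

/-- Decisions are final: a growing local DAG keeps them. -/
lemma statesFrom_persist (hbyz : byz.card ≤ f) (hH : HonestBlocks H)
    (hD : IsLocalDag byz H D) (hE : IsLocalDag byz H E) (hDE : D ⊆ E) (L : List (ℕ × ℕ)) :
    List.Forall₂ (fun s t => s.1 = t.1 ∧ s.2.Persist t.2) (statesFrom C D L [])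
      (statesFrom C E L []) := by
  induction L with
  | nil => exact .nil
  | cons s L ih =>
    have hagree := statesFrom_agree (C := C) hbyz hH hD hE (s :: L)
    simp only [statesFrom_cons, List.forall₂_cons] at hagree
    refine .cons ⟨rfl, fun h => (hagree.1.2 h ?_).symm⟩ ih
    by_cases hd : directDecide C D s.1 s.2 = .undecided
    · dsimp only at h
      rw [decideSlot_of_indirect hd] at h
      obtain ⟨ρ, a, ha⟩ := exists_anchor_of_indirectDecide h
      exact decideSlot_ne_undecided (anchor?_persist ih ha)
    · have := directDecide_ne_undecided_mono hD hDE hd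
      rwa [decideSlot_of_direct rfl this]

/-! ### Slots above the highest round -/

lemma mem_slots {s : ℕ × ℕ} {N : ℕ} :
    s ∈ slots C N ↔ 1 ≤ s.1 ∧ s.1 ≤ N ∧ s.2 < C.leadersPerRound := by
  obtain ⟨r, k⟩ := s
  simp only [slots, List.mem_flatMap, List.mem_range'_1, List.mem_map, List.mem_range,
    Prod.mk.injEq]
  constructor
  · rintro ⟨a, ha, b, hb, rfl, rfl⟩
    omega
  · rintro ⟨h1, h2, h3⟩
    exact ⟨r, by omega, k, h3, rfl, rfl⟩

lemma slots_add (N M : ℕ) : slots C (N + M) = slots C N ++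
    (List.range' (N + 1) M).flatMap fun r =>
      (List.range C.leadersPerRound).map fun rank => (r, rank) := by
  unfold slots
  rw [← List.flatMap_append, Nat.add_comm N 1, ← List.range'_append_1]

lemma leaderSequence_append {S T : List (ℕ × Status f P)}
    (hT : ∀ s ∈ T, s.2 = .undecided) : leaderSequence (S ++ T) = leaderSequence S := by
  induction S with
  | nil =>
    cases T with
    | nil => rfl
    | cons t T =>
      obtain ⟨r, σ⟩ := t
      obtain rfl : σ = .undecided := hT (r, σ) (by simp)
      simp [leaderSequence]
  | cons s S ih =>
    obtain ⟨r, σ⟩ := s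
    cases σ <;> simp [leaderSequence, ih]

lemma indirectDecide_append {r rank : ℕ} {S T : List (ℕ × Status f P)}
    (hT : ∀ s ∈ T, s.2 = .undecided) :
    indirectDecide C D r rank (S ++ T) = indirectDecide C D r rank S := by
  classical
  by_cases h : ∃ s, anchor? r S = some s
  · obtain ⟨s, hs⟩ := h
    have : anchor? r (S ++ T) = some s := by
      unfold anchor? at hs ⊢
      rw [List.find?_append, hs]
      rfl
    unfold indirectDecide
    unfold anchor? at hs this
    rw [hs, this]
  · have h1 : indirectDecide C D r rank S = .undecided := by
      by_contra hne
      obtain ⟨ρ, a, ha⟩ := exists_anchor_of_indirectDecide hne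
      exact h ⟨_, ha⟩
    rw [h1]
    by_contra hne
    obtain ⟨ρ, a, ha⟩ := exists_anchor_of_indirectDecide hne
    have hS : anchor? r S = none := by
      by_contra hn
      exact h (Option.ne_none_iff_exists'.1 hn)
    unfold anchor? at hS ha
    rw [List.find?_append, hS, Option.none_or] at ha
    simpa using hT _ (List.mem_of_find?_eq_some ha)

lemma statesFrom_append_undecided {L : List (ℕ × ℕ)} {S T : List (ℕ × Status f P)}
    (hT : ∀ s ∈ T, s.2 = .undecided) :
    statesFrom C D L (S ++ T) = statesFrom C D L S ++ T := by
  induction L with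
  | nil => rfl
  | cons s L ih =>
    rw [statesFrom_cons, statesFrom_cons, ih]
    unfold decideSlot
    rw [indirectDecide_append hT, List.cons_append]

lemma statesFrom_undecided {L : List (ℕ × ℕ)}
    (h : ∀ s ∈ L, directDecide C D s.1 s.2 = .undecided) :
    ∀ s ∈ statesFrom C D L [], s.2 = .undecided := by
  induction L with
  | nil => simp
  | cons s L ih =>
    have ih := ih fun t ht => h t (List.mem_cons_of_mem _ ht)
    intro t ht
    rw [statesFrom_cons, List.mem_cons] at ht
    rcases ht with rfl | ht
    · dsimp only
      rw [decideSlot_of_indirect (h s (by simp))]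
      exact indirectDecide_append (S := []) ih
    · exact ih t ht

/-- The slots above the highest round do not affect the leader sequence, so that DAGs of different
heights can be compared on a common list of slots. -/
lemma leaderSequence_tryDecide {N : ℕ} (hN : D.sup Block.round ≤ N) :
    leaderSequence (tryDecide C D) = leaderSequence (statesFrom C D (slots C N) []) := by
  obtain ⟨M, rfl⟩ := Nat.exists_eq_add_of_le hN
  have h := statesFrom_undecided (C := C) (D := D)
    (L := (List.range' (D.sup Block.round + 1) M).flatMap fun r =>
      (List.range C.leadersPerRound).map fun rank => (r, rank)) (by
    intro s hs
    simp only [List.mem_flatMap, List.mem_range'_1, List.mem_map] at hs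
    obtain ⟨r, hr, k, -, rfl⟩ := hs
    refine directDecide_eq_undecided fun b hb => ?_
    have := Finset.le_sup (f := Block.round) hb
    dsimp only
    omega)
  have h2 := statesFrom_append_undecided (C := C) (D := D) (S := [])
    (L := slots C (D.sup Block.round)) h
  rw [List.nil_append] at h2
  rw [slots_add, statesFrom_append, h2, leaderSequence_append h]
  rfl

/-! ### Prefixes -/

lemma leaderSequence_agree {S T : List (ℕ × Status f P)}
    (h : List.Forall₂ (fun s t => s.1 = t.1 ∧ s.2.Agree t.2) S T) :
    leaderSequence S <+: leaderSequence T ∨ leaderSequence T <+: leaderSequence S := by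
  induction h with
  | nil => simp
  | @cons s t S T hst hST ih =>
    obtain ⟨r, σ⟩ := s
    obtain ⟨r', τ⟩ := t
    have hst := hst.2
    cases σ <;> cases τ <;> simp_all [leaderSequence, Status.Agree]

lemma leaderSequence_persist {S T : List (ℕ × Status f P)}
    (h : List.Forall₂ (fun s t => s.1 = t.1 ∧ s.2.Persist t.2) S T) :
    leaderSequence S <+: leaderSequence T := by
  induction h with
  | nil => simp
  | @cons s t S T hst hST ih =>
    obtain ⟨r, σ⟩ := s
    obtain ⟨r', τ⟩ := t
    have hst := hst.2
    cases σ <;> cases τ <;> simp_all [leaderSequence, Status.Persist]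

lemma exists_mem_of_mem_leaderSequence {S : List (ℕ × Status f P)} {b : Block f P}
    (h : b ∈ leaderSequence S) : ∃ ρ, (ρ, Status.commit b) ∈ S := by
  induction S with
  | nil => simp [leaderSequence] at h
  | cons s S ih =>
    obtain ⟨r, σ⟩ := s
    cases σ with
    | undecided => simp [leaderSequence] at h
    | skip =>
      obtain ⟨ρ, hρ⟩ := ih (by simpa [leaderSequence] using h)
      exact ⟨ρ, List.mem_cons_of_mem _ hρ⟩
    | commit c =>
      rw [leaderSequence, List.mem_cons] at h
      rcases h with rfl | h
      · exact ⟨r, by simp⟩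
      · obtain ⟨ρ, hρ⟩ := ih h
        exact ⟨ρ, List.mem_cons_of_mem _ hρ⟩

lemma mem_dag_of_mem_leaderSequence {b : Block f P} (h : b ∈ leaderSequence (tryDecide C D)) :
    b ∈ D := by
  obtain ⟨ρ, hρ⟩ := exists_mem_of_mem_leaderSequence h
  exact (mem_dag_of_mem_statesFrom hρ).1

lemma linearizeSubDags_concat (L : List (Block f P)) (b : Block f P) :
    ∃ A : List (Block f P), linearizeSubDags C D (L ++ [b]) = linearizeSubDags C D L ++ A ∧
      A.Nodup ∧ ∀ a, a ∈ A ↔ a ∈ D ∧ Link a b ∧ a ∉ linearizeSubDags C D L := by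
  classical
  refine ⟨_, by unfold linearizeSubDags; rw [List.foldl_append, List.foldl_cons, List.foldl_nil],
    C.order_nodup _, fun a => ?_⟩
  rw [C.mem_order, Finset.mem_filter]
  rfl

lemma linearizeSubDags_prefix {L L' : List (Block f P)} (h : L <+: L') :
    linearizeSubDags C D L <+: linearizeSubDags C D L' := by
  obtain ⟨K, rfl⟩ := h
  induction K using List.reverseRecOn with
  | nil => simp
  | append_singleton K b ih =>
    rw [← List.append_assoc]
    obtain ⟨A, hA, -⟩ := linearizeSubDags_concat (C := C) (D := D) (L ++ K) b
    rw [hA]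
    exact ih.trans (List.prefix_append _ _)

lemma nodup_linearizeSubDags (L : List (Block f P)) : (linearizeSubDags C D L).Nodup := by
  induction L using List.reverseRecOn with
  | nil => simp [linearizeSubDags]
  | append_singleton L b ih =>
    obtain ⟨A, hA, hnd, hmem⟩ := linearizeSubDags_concat (C := C) (D := D) L b
    rw [hA]
    exact ih.append hnd fun a ha ha' => ((hmem a).1 ha').2.2 ha

lemma mem_linearizeSubDags {L : List (Block f P)} {a : Block f P} :
    a ∈ linearizeSubDags C D L ↔ a ∈ D ∧ ∃ b ∈ L, Link a b := by
  induction L using List.reverseRecOn with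
  | nil => simp [linearizeSubDags]
  | append_singleton L b ih =>
    obtain ⟨A, hA, -, hmem⟩ := linearizeSubDags_concat (C := C) (D := D) L b
    rw [hA, List.mem_append, hmem, ih]
    simp only [List.mem_append, List.mem_singleton, or_and_right, exists_or, exists_eq_left]
    by_cases h : ∃ b ∈ L, Link a b <;> simp +contextual [h]

/-- The linearization depends only on the causal histories of the leader blocks. -/
lemma linearizeSubDags_congr (hD : IsLocalDag byz H D) (hE : IsLocalDag byz H E)
    {L : List (Block f P)} (hLD : ∀ b ∈ L, b ∈ D) (hLE : ∀ b ∈ L, b ∈ E) :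
    linearizeSubDags C D L = linearizeSubDags C E L := by
  classical
  induction L using List.reverseRecOn with
  | nil => rfl
  | append_singleton L b ih =>
    have ih := ih (fun b hb => hLD b (by simp [hb])) (fun b hb => hLE b (by simp [hb]))
    have hbD := hLD b (by simp)
    have hbE := hLE b (by simp)
    have step : ∀ F : Finset (Block f P), linearizeSubDags C F (L ++ [b]) =
        linearizeSubDags C F L ++
          C.order (F.filter fun a => Link a b ∧ a ∉ linearizeSubDags C F L) := by
      intro F
      unfold linearizeSubDags
      rw [List.foldl_append, List.foldl_cons, List.foldl_nil]
    rw [step, step, ih]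
    congr 2
    ext a
    simp only [Finset.mem_filter]
    exact ⟨fun h => ⟨hE.closed b hbE a h.2.1, h.2⟩, fun h => ⟨hD.closed b hbD a h.2.1, h.2⟩⟩

/-- An initial part of the leader sequence of `E` linearizes in the same way in `D`. -/
lemma totalOrdering_prefix (hD : IsLocalDag byz H D) (hE : IsLocalDag byz H E)
    (h : leaderSequence (tryDecide C D) <+: leaderSequence (tryDecide C E)) :
    totalOrdering C D <+: totalOrdering C E := by
  unfold totalOrdering
  rw [linearizeSubDags_congr hD hE (fun b => mem_dag_of_mem_leaderSequence)
    (fun b hb => mem_dag_of_mem_leaderSequence (h.subset hb))]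
  exact linearizeSubDags_prefix h

/-- The total orderings of any two local DAGs are comparable. -/
lemma totalOrdering_comparable (hbyz : byz.card ≤ f) (hH : HonestBlocks H)
    (hD : IsLocalDag byz H D) (hE : IsLocalDag byz H E) :
    totalOrdering C D <+: totalOrdering C E ∨ totalOrdering C E <+: totalOrdering C D := by
  have h := leaderSequence_agree (statesFrom_agree (C := C) hbyz hH hD hE
    (slots C (max (D.sup Block.round) (E.sup Block.round))))
  rw [← leaderSequence_tryDecide (le_max_left _ _),
    ← leaderSequence_tryDecide (le_max_right _ _)] at h
  exact h.imp (totalOrdering_prefix hD hE) (totalOrdering_prefix hE hD)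

/-- The total ordering is only appended to when the local DAG grows. -/
lemma totalOrdering_mono (hbyz : byz.card ≤ f) (hH : HonestBlocks H)
    (hD : IsLocalDag byz H D) (hE : IsLocalDag byz H E) (hDE : D ⊆ E) :
    totalOrdering C D <+: totalOrdering C E := by
  have h := leaderSequence_persist (statesFrom_persist (C := C) hbyz hH hD hE hDE
    (slots C (max (D.sup Block.round) (E.sup Block.round))))
  rw [← leaderSequence_tryDecide (le_max_left _ _),
    ← leaderSequence_tryDecide (le_max_right _ _)] at h
  exact totalOrdering_prefix hD hE h

/-! ### Slots that are decided -/

/-- If all slots of rounds below `N` find a committed anchor among the states `S`, then all slots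
`L` of rounds below `N` in front of `S` are decided: the anchor of such a slot is either one of the
slots `L`, all of which are decided by induction, or the one in `S`. -/
lemma mem_leaderSequence_of_anchors {N : ℕ} {S : List (ℕ × Status f P)}
    (hS : ∀ r < N, ∃ ρ a, anchor? r S = some (ρ, .commit a)) {L : List (ℕ × ℕ)}
    (hL : ∀ s ∈ L, s.1 < N) :
    (∀ r < N, ∃ ρ a, anchor? r (statesFrom C D L S) = some (ρ, .commit a)) ∧
    ∀ s ∈ L, ∀ b, directDecide C D s.1 s.2 = .commit b →
      b ∈ leaderSequence (statesFrom C D L S) := by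
  induction L with
  | nil => exact ⟨hS, by simp⟩
  | cons s L ih =>
    obtain ⟨ih1, ih2⟩ := ih fun t ht => hL t (List.mem_cons_of_mem _ ht)
    rw [statesFrom_cons]
    obtain ⟨ρ, a, ha⟩ := ih1 s.1 (hL s (by simp))
    have hdec := decideSlot_ne_undecided (C := C) (D := D) (rank := s.2) ha
    constructor
    · intro r hr
      rw [anchor?_cons]
      split_ifs with h
      · cases hσ : decideSlot C D s.1 s.2 (statesFrom C D L S) with
        | undecided => exact absurd hσ hdec
        | skip => exact absurd hσ h.2
        | commit b => exact ⟨_, _, rfl⟩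
      · exact ih1 r hr
    · intro t ht b hb
      rcases List.mem_cons.1 ht with rfl | ht
      · rw [decideSlot_of_direct hb (by simp)]
        simp [leaderSequence]
      · have := ih2 t ht b hb
        cases hσ : decideSlot C D s.1 s.2 (statesFrom C D L S) with
        | undecided => exact absurd hσ hdec
        | skip => simpa [leaderSequence] using this
        | commit b => simp [leaderSequence, this]

lemma anchor?_append_of_forall_le {r : ℕ} {S T : List (ℕ × Status f P)}
    (h : ∀ s ∈ S, s.1 ≤ r + 1) : anchor? r (S ++ T) = anchor? r T := by
  induction S with
  | nil => rfl
  | cons s S ih =>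
    rw [List.cons_append, anchor?_cons, if_neg, ih fun t ht => h t (List.mem_cons_of_mem _ ht)]
    intro h'
    have := h s (by simp)
    omega

lemma exists_statesFrom_eq_append (L : List (ℕ × ℕ)) (S : List (ℕ × Status f P)) :
    ∃ T, statesFrom C D L S = T ++ S ∧ ∀ s ∈ T, ∃ t ∈ L, s.1 = t.1 := by
  induction L with
  | nil => exact ⟨[], rfl, by simp⟩
  | cons s L ih =>
    obtain ⟨T, hT, h⟩ := ih
    refine ⟨(s.1, decideSlot C D s.1 s.2 (statesFrom C D L S)) :: T, by simp [hT], ?_⟩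
    intro t ht
    rcases List.mem_cons.1 ht with rfl | ht
    · exact ⟨s, by simp, rfl⟩
    · obtain ⟨u, hu, h⟩ := h t ht
      exact ⟨u, List.mem_cons_of_mem _ hu, h⟩

/-- Two consecutive rounds `N` and `N + 1` whose highest-ranked slots are directly committed decide
all slots of earlier rounds, so that direct commits of earlier slots enter the leader sequence. -/
lemma mem_leaderSequence_of_consecutive_commits {N r rank : ℕ} {b b₀ b₁ : Block f P}
    (h₀ : directDecide C D N 0 = .commit b₀) (h₁ : directDecide C D (N + 1) 0 = .commit b₁)
    (hr : 1 ≤ r) (hrN : r < N) (hrank : rank < C.leadersPerRound)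
    (hb : directDecide C D r rank = .commit b) : b ∈ leaderSequence (tryDecide C D) := by
  obtain ⟨K, rfl⟩ : ∃ K, N = K + 1 := ⟨N - 1, by omega⟩
  obtain ⟨ℓ, hℓ⟩ : ∃ ℓ, C.leadersPerRound = ℓ + 1 :=
    ⟨C.leadersPerRound - 1, by have := C.one_le_leaders; omega⟩
  set M := D.sup Block.round
  rw [leaderSequence_tryDecide (show D.sup Block.round ≤ K + (M + 2) by omega), slots_add,
    statesFrom_append]
  refine (mem_leaderSequence_of_anchors (N := K + 1) ?_ ?_).2 (r, rank)
    (mem_slots.2 ⟨hr, by dsimp only; omega, hrank⟩) b hb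
  · rw [List.range'_succ, List.range'_succ, List.flatMap_cons, List.flatMap_cons, hℓ,
      List.range_succ_eq_map, List.map_cons, List.map_cons, List.cons_append, List.cons_append,
      statesFrom_cons, decideSlot_of_direct h₀ (by simp), statesFrom_append, statesFrom_cons,
      decideSlot_of_direct h₁ (by simp)]
    intro r hr
    rw [anchor?_cons]
    split_ifs with h
    · exact ⟨_, _, rfl⟩
    · -- for the slots of round `N - 1` the anchor lies in round `N + 1`
      obtain ⟨T, hT, hTr⟩ := exists_statesFrom_eq_append (C := C) (D := D)
        (List.map (fun rank => (K + 1, rank)) (List.map Nat.succ (List.range ℓ)))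
        ((K + 1 + 1, Status.commit b₁) :: statesFrom C D
          (List.map (fun rank => (K + 1 + 1, rank)) (List.map Nat.succ (List.range ℓ)) ++
            List.flatMap (fun r => (0 :: List.map Nat.succ (List.range ℓ)).map fun rank =>
              (r, rank)) (List.range' (K + 1 + 1 + 1) M)) [])
      have hr' : K ≤ r := by
        by_contra hlt
        exact h ⟨by dsimp only; omega, by simp⟩
      refine ⟨K + 1 + 1, b₁, ?_⟩
      dsimp only [List.map_cons] at hT ⊢
      rw [hT, anchor?_append_of_forall_le, anchor?_cons, if_pos]
      · exact ⟨by dsimp only; omega, by simp⟩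
      · intro s hs
        obtain ⟨t, ht, hst⟩ := hTr s hs
        simp only [List.mem_map] at ht
        obtain ⟨_, -, rfl⟩ := ht
        dsimp only at hst
        omega
  · intro s hs
    have := (mem_slots.1 hs).2.1
    omega

end States

/-! ### Local DAGs in a run -/

namespace Run

/-- The blocks that honest validators broadcast. -/
def honestBlocks (X : Run f P) : Set (Block f P) :=
  {b | X.Honest b.author ∧ ∃ t, X.bcast b.author b t}

namespace IsExecution

variable {C : Config f P} {X : Run f P}

lemma mem_dag {p : Validator f} {t : ℝ} {b : Block f P} :
    b ∈ X.dag p t ↔ b ∈ X.recv p t ∧ ∀ a, Link a b → a ∈ X.recv p t ∧ WellFormed a := by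
  classical
  simp [Run.dag, acceptedDag]

lemma dag_mono (hX : X.IsExecution C) {p : Validator f} (hp : X.Honest p) {s t : ℝ} (h : s ≤ t) :
    X.dag p s ⊆ X.dag p t := fun b hb => by
  obtain ⟨h1, h2⟩ := mem_dag.1 hb
  exact mem_dag.2 ⟨hX.recv_mono p hp s t h h1, fun a ha =>
    (h2 a ha).imp_left fun h' => hX.recv_mono p hp s t h h'⟩

lemma exists_bcast_of_mem_dag (hX : X.IsExecution C) {p : Validator f} (hp : X.Honest p) {t : ℝ}
    {b : Block f P} (hb : b ∈ X.dag p t) :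
    ∃ s ≤ t, X.bcast b.author b s ∧ (b.author ≠ p → s < t) :=
  hX.authentic p hp t b (mem_dag.1 hb).1

lemma dag_closed {p : Validator f} {t : ℝ} {b : Block f P} (hb : b ∈ X.dag p t)
    {a : Block f P} (h : Link a b) : a ∈ X.dag p t := by
  obtain ⟨-, h2⟩ := mem_dag.1 hb
  exact mem_dag.2 ⟨(h2 a h).1, fun c hc => h2 c (hc.trans h)⟩

lemma dag_wellFormed {p : Validator f} {t : ℝ} {b : Block f P} (hb : b ∈ X.dag p t) :
    WellFormed b := ((mem_dag.1 hb).2 b Relation.ReflTransGen.refl).2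

lemma honestBlocks_spec (hX : X.IsExecution C) : HonestBlocks X.honestBlocks where
  unique := by
    rintro b ⟨hb, t, hbt⟩ c ⟨-, s, hcs⟩ hauthor hround
    rw [← hauthor] at hcs
    exact ((hX.follows _ hb).once b t c s hbt hcs hround).1
  parents_nodup := by
    rintro b ⟨hb, t, hbt⟩
    rcases (hX.follows _ hb).wellFormed b t hbt with ⟨-, h⟩ | ⟨h, -⟩
    · simp [h]
    · exact ((hX.follows _ hb).create b t (b.round - 1) hbt (by omega) (by omega)).2.2.1

lemma isLocalDag (hX : X.IsExecution C) {p : Validator f} (hp : X.Honest p) (t : ℝ) :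
    IsLocalDag X.byzantine X.honestBlocks (X.dag p t) where
  closed _ hb _ h := dag_closed hb h
  wellFormed _ hb := dag_wellFormed hb
  honest_mem b hb hbyz := by
    obtain ⟨s, -, hs, -⟩ := hX.exists_bcast_of_mem_dag hp hb
    exact ⟨hbyz, s, hs⟩

/-- Blocks of honest validators are accepted: their parents come from the author's local DAG. -/
lemma wellFormed_of_link (hX : X.IsExecution C) {p : Validator f} (hp : X.Honest p)
    {b : Block f P} {t : ℝ} (hb : X.bcast p b t) {a : Block f P} (h : Link a b) :
    WellFormed a := by
  have hwf := (hX.follows p hp).wellFormed b t hb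
  rcases h.eq_or_exists_parent with rfl | ⟨c, hc, hac⟩
  · exact hwf
  · rcases hwf with ⟨-, h⟩ | ⟨h, -⟩
    · simp [h] at hc
    · have := ((hX.follows p hp).create b t (b.round - 1) hb (by omega) (by omega)).2.1 c hc
      exact dag_wellFormed (dag_closed this hac)

lemma mem_dag_of_bcast (hX : X.IsExecution C) {p q : Validator f} (hp : X.Honest p)
    (hq : X.Honest q) {b : Block f P} {s t : ℝ} (hb : X.bcast p b s)
    (ht : max s X.gst + X.delta ≤ t) : b ∈ X.dag q t :=
  mem_dag.2 ⟨hX.delivery p hp q hq b s hb b Relation.ReflTransGen.refl t ht, fun a ha =>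
    ⟨hX.delivery p hp q hq b s hb a ha t ht, hX.wellFormed_of_link hp hb ha⟩⟩

lemma le_card_honest (hX : X.IsExecution C) (S : Finset (Validator f)) :
    S.card ≤ (S \ X.byzantine).card + f :=
  card_le_card_sdiff_add hX.byzantine_card S

lemma le_card_of_forall_honest (hX : X.IsExecution C) {S : Finset (Validator f)}
    (h : ∀ v, X.Honest v → v ∈ S) : 4 * f + 1 ≤ S.card := by
  have h1 := hX.le_card_honest Finset.univ
  rw [Finset.card_univ, Fintype.card_fin] at h1
  have h2 : (Finset.univ \ X.byzantine).card ≤ S.card :=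
    Finset.card_le_card fun v hv => h v (Finset.mem_sdiff.1 hv).2
  omega

lemma le_card_round (hX : X.IsExecution C) {p : Validator f} (hp : X.Honest p) {t : ℝ}
    {b : Block f P} (hb : b ∈ X.dag p t) {r : ℕ} (hr : 1 ≤ r) (hrb : r < b.round) :
    4 * f + 1 ≤ (authorsOf (X.dag p t) fun c => c.round = r).card :=
  (card_authorsOf_history (hX.isLocalDag hp t).closed (hX.isLocalDag hp t).wellFormed hb hr
    hrb).trans (Finset.card_le_card (authorsOf_mono subset_rfl fun _ _ h => h.1))

/-! ### Progress of honest validators -/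

/-- Early block production lets a validator catch up: once it holds round-`(r + 1)` blocks of
`2f + 1` validators, it has broadcast its own. For each leader of round `r` these blocks either
reference a block of the leader, or are the blames that allow the validator to proceed. -/
lemma catch_up (hX : X.IsExecution C) {p : Validator f} (hp : X.Honest p) {t : ℝ}
    (hstart : ∃ b, b.round = 1 ∧ ∃ s ≤ t, X.bcast p b s) (r : ℕ)
    (hr : 2 * f + 1 ≤ (authorsOf (X.dag p t) fun c => c.round = r + 1).card) :
    ∃ b, b.round = r + 1 ∧ ∃ s ≤ t, X.bcast p b s := by
  induction r with
  | zero => exact hstart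
  | succ r ih =>
    obtain ⟨v, hv⟩ := Finset.card_pos.1
      (show 0 < (authorsOf (X.dag p t) fun c => c.round = r + 1 + 1).card by omega)
    obtain ⟨d, hd, hdr, -⟩ := mem_authorsOf.1 hv
    have hquorum := hX.le_card_round hp hd (Nat.le_add_left 1 r) (by omega)
    have hprev := ih (by omega)
    by_cases hown : ∃ c ∈ X.dag p t, c.round = r + 1 + 1 ∧ c.author = p
    · obtain ⟨c, hc, hcr, rfl⟩ := hown
      obtain ⟨s, hs, hcs, -⟩ := hX.exists_bcast_of_mem_dag hp hc
      exact ⟨c, hcr, s, hs, hcs⟩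
    · refine (hX.follows p hp).prompt (r + 1) t (by omega) ⟨⟨hprev, hquorum⟩, Or.inl ?_⟩
      intro rank _
      by_cases hh : X.Holds p (r + 1) (leader f (r + 1) rank) t
      · exact Or.inl hh
      · refine Or.inr (hr.trans (Finset.card_le_card (authorsOf_mono subset_rfl ?_)))
        intro c hc hcr
        refine ⟨hcr, fun h => hown ⟨c, hc, hcr, h⟩, fun a ha hal => hh ⟨a, ?_, ?_, hal⟩⟩
        · exact dag_closed hc (.of_mem_parents ha)
        · rcases dag_wellFormed hc with ⟨h1, -⟩ | ⟨-, -, hround, -⟩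
          · omega
          · have := hround a ha
            omega

/-- Every honest validator broadcasts a block in every round. -/
lemma exists_bcast_round (hX : X.IsExecution C) (r : ℕ) :
    ∃ T, ∀ p, X.Honest p → ∃ b, b.round = r + 1 ∧ ∃ s ≤ T, X.bcast p b s := by
  suffices h : ∀ p, ∃ T, X.Honest p → ∃ b, b.round = r + 1 ∧ ∃ s ≤ T, X.bcast p b s by
    choose T hT using h
    obtain ⟨M, hM⟩ := Finite.exists_le T
    refine ⟨M, fun p hp => ?_⟩
    obtain ⟨b, hb, s, hs, hbs⟩ := hT p hp
    exact ⟨b, hb, s, hs.trans (hM p), hbs⟩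
  intro p
  by_cases hp : X.Honest p
  swap
  · exact ⟨0, fun h => absurd h hp⟩
  induction r generalizing p with
  | zero =>
    obtain ⟨b, t, hb, hbr⟩ := (hX.follows p hp).start
    exact ⟨t, fun _ => ⟨b, hbr, t, le_rfl, hb⟩⟩
  | succ r ih =>
    choose! T hT using ih
    obtain ⟨M, hM⟩ := Finite.exists_le T
    set τ := max M X.gst + X.delta
    have hready : X.QuorumReady p (r + 1) τ := by
      constructor
      · obtain ⟨b, hb, s, hs, hbs⟩ := hT p hp hp
        refine ⟨b, hb, s, ?_, hbs⟩
        have := hX.delta_pos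
        have := hM p
        have := le_max_left M X.gst
        simp only [τ]
        linarith
      · refine hX.le_card_of_forall_honest fun v hv => ?_
        obtain ⟨b, hb, s, hs, hbs⟩ := hT v hv hv
        refine mem_authorsOf.2 ⟨b, hX.mem_dag_of_bcast hv hp hbs ?_, hb,
          ((hX.follows v hv).own b s hbs).1⟩
        have := max_le_max_right X.gst (hs.trans (hM v))
        simp only [τ]
        linarith
    have hlater : X.QuorumReady p (r + 1) (τ + 2 * X.delta) := by
      have hle : τ ≤ τ + 2 * X.delta := by
        have := hX.delta_pos
        linarith
      obtain ⟨⟨b, hb, s, hs, hbs⟩, hq⟩ := hready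
      exact ⟨⟨b, hb, s, hs.trans hle, hbs⟩, hq.trans
        (Finset.card_le_card (authorsOf_mono (hX.dag_mono hp hle) fun _ _ h => h))⟩
    refine ⟨τ + 2 * X.delta, fun _ =>
      (hX.follows p hp).prompt (r + 1) _ (by omega) ⟨hlater, Or.inr ?_⟩⟩
    rwa [add_sub_cancel_right]

/-- Every honest validator eventually holds the round-`r` blocks of all honest validators. -/
lemma exists_forall_mem_dag (hX : X.IsExecution C) {q : Validator f} (hq : X.Honest q) {r : ℕ}
    (hr : 1 ≤ r) : ∃ T, ∀ t ≥ T, ∀ p, X.Honest p →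
      ∃ b ∈ X.dag q t, b.round = r ∧ b.author = p ∧ ∃ s, X.bcast p b s := by
  obtain ⟨r, rfl⟩ := Nat.exists_eq_add_of_le' hr
  obtain ⟨M, hM⟩ := hX.exists_bcast_round r
  refine ⟨max M X.gst + X.delta, fun t ht p hp => ?_⟩
  obtain ⟨b, hb, s, hs, hbs⟩ := hM p hp
  refine ⟨b, hX.mem_dag_of_bcast hp hq hbs ?_, hb, ((hX.follows p hp).own b s hbs).1, s, hbs⟩
  have := max_le_max_right X.gst hs
  linarith

/-! ### Honest leaders after stabilization -/

/-- From some round `R` on, nothing happens before a time `T`, at which the network has stabilized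
and all honest validators have started. -/
lemma exists_stable_round (hX : X.IsExecution C) : ∃ R : ℕ, 2 ≤ R ∧ ∃ T : ℝ, X.gst ≤ T ∧
    (∀ p, X.Honest p → ∃ b, b.round = 1 ∧ ∃ s ≤ T, X.bcast p b s) ∧
    ∀ p, X.Honest p → ∀ t, ∀ b ∈ X.dag p t, R ≤ b.round → T ≤ t := by
  obtain ⟨T₀, hT₀⟩ := hX.exists_bcast_round 0
  set T := max T₀ X.gst
  obtain ⟨R, hR⟩ := Finite.exists_le fun p => (X.recv p T).sup Block.round
  refine ⟨R + 2, by omega, T, le_max_right _ _, fun p hp => ?_, fun p hp t b hb hbr => ?_⟩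
  · obtain ⟨b, hb, s, hs, hbs⟩ := hT₀ p hp
    exact ⟨b, hb, s, hs.trans (le_max_left _ _), hbs⟩
  · by_contra hlt
    have h1 := hX.recv_mono p hp t T (le_of_not_ge hlt) (mem_dag.1 hb).1
    have h2 := (Finset.le_sup (f := Block.round) h1).trans (hR p)
    omega

/-- After stabilization, all honest validators reference the blocks of an honest leader. Otherwise
consider the first honest block of round `r + 1` that does not. Its author cannot have proceeded
because of blames, since an honest blame would be an earlier such block. It has thus waited for
`2 * delta` after holding a quorum of round-`r` blocks; within `delta`, the honest ones of these
reach the leader and let it catch up, and within another `delta` the leader's block arrives. -/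
lemma exists_parent_honest_leader (hX : X.IsExecution C) : ∃ R : ℕ, 2 ≤ R ∧ ∀ r ≥ R,
    ∀ rank < C.leadersPerRound, X.Honest (leader f r rank) →
    ∀ p, X.Honest p → ∀ b t, X.bcast p b t → b.round = r + 1 →
      ∃ a ∈ b.parents, a.author = leader f r rank := by
  classical
  obtain ⟨R, hR2, T, hT, hstart, hstable⟩ := hX.exists_stable_round
  refine ⟨R, hR2, fun r hr rank hrank hl => ?_⟩
  set l := leader f r rank with hldef
  by_contra! hbad
  -- the earliest offending block
  let bad : Finset (Validator f) := Finset.univ.filter fun p => X.Honest p ∧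
    ∃ b t, X.bcast p b t ∧ b.round = r + 1 ∧ ∀ a ∈ b.parents, a.author ≠ l
  have hbadne : bad.Nonempty := by
    obtain ⟨p, hp, b, t, h⟩ := hbad
    exact ⟨p, by simpa [bad] using ⟨hp, b, ⟨t, h.1⟩, h.2⟩⟩
  have htime : ∀ p, ∃ t, p ∈ bad → ∃ b, X.bcast p b t ∧ b.round = r + 1 ∧
      ∀ a ∈ b.parents, a.author ≠ l := by
    intro p
    by_cases h : p ∈ bad
    · obtain ⟨-, b, t, h'⟩ := (Finset.mem_filter.1 h).2
      exact ⟨t, fun _ => ⟨b, h'⟩⟩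
    · exact ⟨0, fun h' => absurd h' h⟩
  choose time htime using htime
  obtain ⟨p, hpbad, hmin⟩ := bad.exists_min_image time hbadne
  obtain ⟨b, hb, hbr, hbl⟩ := htime p hpbad
  have hp : X.Honest p := ((Finset.mem_filter.1 hpbad).2).1
  set t := time p
  obtain ⟨⟨hready, hadv⟩, -, -, href⟩ := (hX.follows p hp).create b t r hb (by omega) hbr
  have hnot : ¬ X.Holds p r l t := fun h => by
    obtain ⟨a, ha, hal⟩ := href rank hrank h
    exact hbl a ha hal
  rcases hadv with hadv | hwait
  · have hblamed : X.Blamed p r l t := (hadv rank hrank).resolve_left hnot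
    have h1 := hX.le_card_honest (authorsOf (X.dag p t) fun c =>
      c.round = r + 1 ∧ c.author ≠ p ∧ ∀ a ∈ c.parents, a.author ≠ l)
    have h2 : 2 * f + 1 ≤ _ := hblamed
    obtain ⟨v, hv⟩ := Finset.card_pos.1 (show 0 < ((authorsOf (X.dag p t) fun c =>
      c.round = r + 1 ∧ c.author ≠ p ∧ ∀ a ∈ c.parents, a.author ≠ l) \ X.byzantine).card by omega)
    obtain ⟨hv, hvh⟩ := Finset.mem_sdiff.1 hv
    obtain ⟨c, hc, ⟨hcr, hcp, hcl⟩, rfl⟩ := mem_authorsOf.1 hv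
    obtain ⟨s, -, hs, hst⟩ := hX.exists_bcast_of_mem_dag hp hc
    have hcbad : c.author ∈ bad := by
      simpa [bad] using ⟨hvh, c, ⟨s, hs⟩, hcr, hcl⟩
    obtain ⟨c', hc', hcr', -⟩ := htime c.author hcbad
    have h3 := ((hX.follows _ hvh).once c s c' _ hs hc' (hcr.trans hcr'.symm)).2
    have h4 := hmin c.author hcbad
    have h5 := hst hcp
    exact absurd h4 (not_le.2 (h3 ▸ h5))
  · -- a quorum of round-`r` blocks is held at time `τ` already, `2 * delta` before `t`
    set τ := t - 2 * X.delta with hτ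
    have hδ := hX.delta_pos
    have hquorum := hwait.2
    have hTτ : T ≤ τ := by
      obtain ⟨v, hv⟩ := Finset.card_pos.1
        (show 0 < (authorsOf (X.dag p τ) fun c => c.round = r).card by omega)
      obtain ⟨c, hc, hcr, -⟩ := mem_authorsOf.1 hv
      exact hstable p hp τ c hc (by omega)
    have hmax : ∀ s ≤ τ, max s X.gst ≤ τ := fun s hs => max_le hs (hT.trans hTτ)
    have hl2 : 2 * f + 1 ≤
        (authorsOf (X.dag l (τ + X.delta)) fun c => c.round = r - 1 + 1).card := by
      have h1 := hX.le_card_honest (authorsOf (X.dag p τ) fun c => c.round = r)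
      refine le_trans (show 2 * f + 1 ≤
        ((authorsOf (X.dag p τ) fun c => c.round = r) \ X.byzantine).card by omega)
        (Finset.card_le_card fun v hv => ?_)
      obtain ⟨hv, hvh⟩ := Finset.mem_sdiff.1 hv
      obtain ⟨c, hc, hcr, rfl⟩ := mem_authorsOf.1 hv
      obtain ⟨s, hsτ, hs, -⟩ := hX.exists_bcast_of_mem_dag hp hc
      have := hmax s hsτ
      exact mem_authorsOf.2 ⟨c, hX.mem_dag_of_bcast hvh hl hs (by linarith), by omega, rfl⟩
    obtain ⟨c₁, hc₁, s₁, hs₁, hcs₁⟩ := hstart l hl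
    obtain ⟨a, har, s, hs, has⟩ := hX.catch_up hl
      ⟨c₁, hc₁, s₁, hs₁.trans (by linarith), hcs₁⟩ (r - 1) hl2
    refine hnot ⟨a, hX.mem_dag_of_bcast hl hp has ?_, by omega, ((hX.follows l hl).own a s has).1⟩
    have : max s X.gst ≤ τ + X.delta := max_le hs (by linarith)
    linarith

/-- After stabilization, every honest validator eventually commits every slot of an honest leader
directly, and keeps doing so. -/
lemma exists_directDecide_eq_commit (hX : X.IsExecution C) : ∃ R : ℕ, 2 ≤ R ∧ ∀ r ≥ R,
    ∀ rank < C.leadersPerRound, X.Honest (leader f r rank) → ∀ q, X.Honest q →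
    ∃ T, ∀ t ≥ T, ∃ b, directDecide C (X.dag q t) r rank = .commit b := by
  obtain ⟨R, hR2, hR⟩ := hX.exists_parent_honest_leader
  refine ⟨R, hR2, fun r hr rank hrank hl q hq => ?_⟩
  obtain ⟨T, hT⟩ := hX.exists_forall_mem_dag hq (show 1 ≤ r + 1 by omega)
  obtain ⟨T', hT'⟩ := hX.exists_forall_mem_dag hq (show 1 ≤ r by omega)
  refine ⟨max T T', fun t ht => ?_⟩
  obtain ⟨b, hb, hbr, hba, s, hbs⟩ := hT' t ((le_max_right _ _).trans ht) _ hl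
  refine exists_directDecide_eq_commit_of_supporters (mem_leaderBlocks.2 ⟨hb, hbr, hba⟩)
    (hX.le_card_of_forall_honest fun p hp => ?_)
  obtain ⟨c, hc, hcr, hcp, s', hcs⟩ := hT t ((le_max_left _ _).trans ht) p hp
  obtain ⟨a, ha, hal⟩ := hR r hr rank hrank hl p hp c s' hcs hcr
  have haD := dag_closed hc (.of_mem_parents ha)
  obtain ⟨s'', -, has, -⟩ := hX.exists_bcast_of_mem_dag hq haD
  have har : a.round = b.round := by
    rcases dag_wellFormed hc with ⟨h1, -⟩ | ⟨-, -, hround, -⟩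
    · omega
    · have := hround a ha
      omega
  rw [hal] at has
  obtain rfl := ((hX.follows _ hl).once a s'' b s has hbs har).1
  exact mem_authorsOf.2 ⟨c, hc, ⟨by omega, ha⟩, hcp⟩

/-- Some two consecutive validators are honest, since `f` Byzantine ones break at most `2f` of the
`5f + 1` cyclically consecutive pairs. -/
lemma exists_consecutive_honest (hX : X.IsExecution C) : ∃ v, X.Honest v ∧ X.Honest (v + 1) := by
  classical
  by_contra! h
  have hsub : Finset.univ ⊆ X.byzantine ∪ X.byzantine.image fun v => v - 1 := by
    intro v _
    by_cases hv : v ∈ X.byzantine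
    · exact Finset.mem_union_left _ hv
    · exact Finset.mem_union_right _ (Finset.mem_image.2
        ⟨v + 1, not_not.1 (h v hv), by simp⟩)
  have h1 := Finset.card_le_card hsub
  have h2 := Finset.card_union_le X.byzantine (X.byzantine.image fun v => v - 1)
  have h3 : (X.byzantine.image fun v => v - 1).card ≤ X.byzantine.card := Finset.card_image_le
  have h4 := hX.byzantine_card
  rw [Finset.card_univ, Fintype.card_fin] at h1
  omega

lemma leader_add_mul (v : Validator f) (k : ℕ) :
    leader f (v + (5 * f + 1) * k) 0 = v := by
  ext
  simp [leader, Nat.mod_eq_of_lt v.isLt]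

lemma leader_succ (r : ℕ) : leader f (r + 1) 0 = leader f r 0 + 1 := by
  ext
  simp [leader, Fin.val_add]

/-- Every honest validator is the first leader of arbitrarily late rounds, and its blocks of these
rounds enter the leader sequence of every honest validator. -/
lemma exists_mem_leaderSequence (hX : X.IsExecution C) {p : Validator f} (hp : X.Honest p) (k : ℕ) :
    ∃ r ≥ k, 1 ≤ r ∧ ∀ q, X.Honest q → ∃ t, ∃ b ∈ leaderSequence (tryDecide C (X.dag q t)),
      b.author = p ∧ b.round = r := by
  obtain ⟨R, hR2, hR⟩ := hX.exists_directDecide_eq_commit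
  obtain ⟨v, hv, hv'⟩ := hX.exists_consecutive_honest
  have hℓ : 0 < C.leadersPerRound := C.one_le_leaders
  set r := (p : ℕ) + (5 * f + 1) * (k + R) with hr
  have hrk : k + R ≤ r := by nlinarith [Nat.zero_le (p : ℕ), Nat.zero_le (f * (k + R))]
  set N := (v : ℕ) + (5 * f + 1) * (r + 1) with hN
  have hrN : r + 1 ≤ N := by nlinarith [Nat.zero_le (v : ℕ), Nat.zero_le (f * (r + 1))]
  have hlr : leader f r 0 = p := leader_add_mul p _
  have hlN : leader f N 0 = v := leader_add_mul v _
  have hlN' : leader f (N + 1) 0 = v + 1 := by rw [leader_succ, hlN]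
  refine ⟨r, by omega, by omega, fun q hq => ?_⟩
  obtain ⟨T₀, h₀⟩ := hR r (by omega) 0 hℓ (hlr ▸ hp) q hq
  obtain ⟨T₁, h₁⟩ := hR N (by omega) 0 hℓ (hlN ▸ hv) q hq
  obtain ⟨T₂, h₂⟩ := hR (N + 1) (by omega) 0 hℓ (hlN' ▸ hv') q hq
  set t := max T₀ (max T₁ T₂)
  obtain ⟨b₀, hb₀⟩ := h₀ t (le_max_left _ _)
  obtain ⟨b₁, hb₁⟩ := h₁ t ((le_max_left _ _).trans (le_max_right _ _))
  obtain ⟨b₂, hb₂⟩ := h₂ t ((le_max_right _ _).trans (le_max_right _ _))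
  obtain ⟨-, hbr, hba⟩ := mem_leaderBlocks.1 (directDecide_eq_commit hb₀).1
  exact ⟨t, b₀, mem_leaderSequence_of_consecutive_commits hb₁ hb₂ (by omega) (by omega) hℓ hb₀,
    hba.trans hlr, hbr⟩

/-! ### Delivery -/

/-- The blocks of an honest validator form a chain, as each one references its predecessor. -/
lemma link_of_author_eq (hX : X.IsExecution C) {p : Validator f} (hp : X.Honest p)
    {m : Block f P} {s : ℝ} (hm : X.bcast p m s) {q : Validator f} (hq : X.Honest q) {t : ℝ}
    {b : Block f P} (hb : b ∈ X.dag q t) (hbp : b.author = p) (hround : m.round ≤ b.round) :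
    Link m b := by
  obtain ⟨k, hk⟩ := Nat.exists_eq_add_of_le hround
  induction k generalizing b with
  | zero =>
    obtain ⟨s', -, hs', -⟩ := hX.exists_bcast_of_mem_dag hq hb
    rw [hbp] at hs'
    obtain rfl := ((hX.follows p hp).once m s b s' hm hs' (by omega)).1
    exact Relation.ReflTransGen.refl
  | succ k ih =>
    have hm1 : 1 ≤ m.round := by
      rcases (hX.follows p hp).wellFormed m s hm with ⟨h, -⟩ | ⟨h, -⟩ <;> omega
    rcases dag_wellFormed hb with ⟨h1, -⟩ | ⟨-, ⟨a, ha, hab⟩, hr, -⟩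
    · omega
    · have ha' : a ∈ b.parents := List.mem_of_mem_head? ha
      have := hr a ha'
      exact (ih (dag_closed hb (.of_mem_parents ha')) (hab.trans hbp) (by omega)
        (by omega)).trans (.of_mem_parents ha')

lemma validity (hX : X.IsExecution C) {p : Validator f} (hp : X.Honest p) {m : Block f P} {s : ℝ}
    (hm : X.bcast p m s) {q : Validator f} (hq : X.Honest q) :
    ∃ t, m ∈ X.delivered C q t := by
  obtain ⟨r, hr, -, h⟩ := hX.exists_mem_leaderSequence hp m.round
  obtain ⟨t, b, hb, hbp, hbr⟩ := h q hq
  have hbD := mem_dag_of_mem_leaderSequence hb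
  have hlink := hX.link_of_author_eq hp hm hq hbD hbp (by omega)
  exact ⟨t, mem_linearizeSubDags.2 ⟨dag_closed hbD hlink, b, hb, hlink⟩⟩

lemma delivered_comparable (hX : X.IsExecution C) {p q : Validator f} (hp : X.Honest p)
    (hq : X.Honest q) (s t : ℝ) : X.delivered C p s <+: X.delivered C q t ∨
      X.delivered C q t <+: X.delivered C p s :=
  totalOrdering_comparable hX.byzantine_card hX.honestBlocks_spec (hX.isLocalDag hp s)
    (hX.isLocalDag hq t)

/-- The sequence that an honest validator has delivered becomes an initial part of what any other
one has delivered: the two are comparable, and by validity the latter grows beyond any bound. -/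
lemma exists_delivered_prefix (hX : X.IsExecution C) {p q : Validator f} (hp : X.Honest p)
    (hq : X.Honest q) (s : ℝ) : ∃ t, X.delivered C p s <+: X.delivered C q t := by
  obtain ⟨T, hT⟩ := hX.exists_bcast_round ((X.dag p s).sup Block.round)
  obtain ⟨m, hmr, s', -, hm⟩ := hT p hp
  obtain ⟨t, ht⟩ := hX.validity hp hm hq
  refine ⟨t, (hX.delivered_comparable hp hq s t).resolve_right fun h => ?_⟩
  have h1 := (mem_linearizeSubDags.1 (h.subset ht)).1
  have h2 := Finset.le_sup (f := Block.round) h1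
  omega

lemma nodup_delivered (p : Validator f) (t : ℝ) : (X.delivered C p t).Nodup :=
  nodup_linearizeSubDags _

lemma pair_sublist_of_pair_sublist (hX : X.IsExecution C) {p q : Validator f} (hp : X.Honest p)
    (hq : X.Honest q) {m₁ m₂ : Block f P}
    (h : ∃ t, [m₁, m₂].Sublist (X.delivered C p t)) :
    ∃ t, [m₁, m₂].Sublist (X.delivered C q t) := by
  obtain ⟨s, hs⟩ := h
  obtain ⟨t, ht⟩ := hX.exists_delivered_prefix hp hq s
  exact ⟨t, hs.trans ht.sublist⟩

end IsExecution

end Run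

end Odontoceti

theorem mainTheorem3 {f : ℕ} {P : Type u} (C : Odontoceti.Config f P) (X : Odontoceti.Run f P)
    (hX : X.IsExecution C) :
    Odontoceti.ByzantineAtomicBroadcast X.Honest X.bcast (X.delivered C) where
  append_only p hp s t hst :=
    Odontoceti.totalOrdering_mono hX.byzantine_card hX.honestBlocks_spec (hX.isLocalDag hp s)
      (hX.isLocalDag hp t) (hX.dag_mono hp hst)
  validity p hp m t hm q hq := hX.validity hp hm hq
  agreement p hp m t hm q hq := by
    obtain ⟨t', h⟩ := hX.exists_delivered_prefix hp hq t
    exact ⟨t', h.subset hm⟩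
  integrity p hp t := by
    refine ⟨Odontoceti.Run.IsExecution.nodup_delivered p t, fun m hm => ?_⟩
    obtain ⟨s, hs, h, -⟩ :=
      hX.exists_bcast_of_mem_dag hp (Odontoceti.mem_linearizeSubDags.1 hm).1
    exact ⟨m.author, s, hs, h⟩
  total_order p hp q hq m₁ m₂ _ _ _ _ :=
    ⟨hX.pair_sublist_of_pair_sublist hp hq, hX.pair_sublist_of_pair_sublist hq hp⟩
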